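/- **Setting.** A *topological graph* $E=(E^0,E^1,r,s)$ consists of second countable locally compact Hausdorff spaces $E^0,E^1$, a continuous map $r\colon E^1\to E^0$ and a local homeomorphism $s\colon E^1\to E^0$. It is *regular* if every $v\in E^0$ has a precompact open neighbourhood $U$ with $r^{-1}(\overline U)$ compact, and $v\notin\overline{E^0\setminus\overline{r(E^1)}}$. Its graph correspondence $X(E)$ is the $C_0(E^0)$–$C_0(E^0)$-correspondence obtained by completing $C_c(E^1)$ with the operations $(a\cdot x)(e)=a(r(e))x(e)$, $(x\cdot a)(e)=x(e)a(s(e))$, $(x\mid y)(v)=\sum_{s(e)=v}\overline{x(e)}y(e)$. An *out-split* of $E$ is a triple $\mathbb O=(\alpha,E^0_{\mathbb O},\psi)$ with $E^0_{\mathbb O}$ a locally compact Hausdorff space and $\alpha\colon E^0_{\mathbb O}\to E^0$, $\psi\colon E^1\to E^0_{\mathbb O}$ proper surjective local homeomorphisms such that $\alpha\circ\psi=s$. The out-split graph $E_{\mathbb O}$ has vertex space $E^0_{\mathbb O}$, edge space $\{(w,e)\in E^0_{\mathbb O}\times E^1:\alpha(w)=r(e)\}$, range $(w,e)\mapsto w$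 and source $(w,e)\mapsto\psi(e)$. **Proposition.** Let $\mathbb O=(\alpha,E^0_{\mathbb O},\psi)$ be an out-split of a regular topological graph $E$, and let $A=C_0(E^0)$, $B=C_0(E^0_{\mathbb O})$. 1. $\alpha^*(a)=a\circ\alpha$ defines an injective $*$-homomorphism $\alpha^*\colon A\to B$. 2. The formula $\Lambda(b)(v)=\sum_{u\in\alpha^{-1}(v)}b(u)$ defines a linear map $\Lambda\colon C_c(E^0_{\mathbb O})\to C_c(E^0)$ which is positive, faithful ($\Lambda(b^*b)=0$ implies $b=0$) and compatible with $\alpha^*$: $\Lambda(\alpha^*(a_1)\,b\,\alpha^*(a_2))=a_1\Lambda(b)a_2$ for $a_1,a_2\in A$. Let $B^\Lambda$ be the $B$–$A$-correspondence obtained by completing $C_c(E^0_{\mathbb O})$ in the inner product $(b\mid c)_A=\Lambda(b^*c)$, with right action $b\cdot a=b\,\alpha^*(a)$ and left multiplication by $B$. 3. $X(E)$ carries a right $B$-module structure with a definite $B$-valued inner product, given for $x,y\in C_c(E^1)$, $b\in B$ by $$(x\cdot b)(e)=x(e)b(\psi(e)),\qquad (x\mid y)_B(u)=\sum_{e\in\psi^{-1}(u)}\overline{x(e)}y(e).$$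 The left action of $A$ on $X(E)$ is also by adjointable operators for this structure. Moreover, for all $x,y\in X(E)$, $a\in A$, $v\in E^0$, one has $x\cdot\alpha^*(a)=x\cdot a$ and $\sum_{u\in\alpha^{-1}(v)}(x\mid y)_B(u)=(x\mid y)_A(v)$. 4. Let $B^\Lambda\otimes_A X(E)$ be the interior tensor product, that is, the completion of the algebraic tensor product in the inner product $(b_1\otimes x_1\mid b_2\otimes x_2)_B=(x_1\mid (b_1\mid b_2)_A\cdot x_2)_B$, with $B$ acting on the left on $B^\Lambda$ and on the right on $X(E)$. The correspondences $B^\Lambda\otimes_A X(E)$ and $X(E_{\mathbb O})$ over $B$ are isomorphic: there is a linear bijection between them that preserves the $B$-valued inner products and both actions of $B$. 5. Suppose that $\sup_{v}|\alpha^{-1}(v)|<\infty$ (for instance, $E^0$ compact). Then $\Lambda$ extends, by the same formula, to a bounded positive faithful linear map $\Lambda\colon B\to A$ with $\Lambda(\alpha^*(a_1)\,b\,\alpha^*(a_2))=a_1\Lambda(b)a_2$ and $\Lambda((x\mid y)_B)=(x\mid y)_A$ for all $x,y\in X(E)$; $X(E)$ is complete in the norm given by $(\cdot\mid\cdot)_B$,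 so it is an $A$–$B$-correspondence; and $B^\Lambda$ is the completion of all of $B$: the inclusion $C_c(E^0_{\mathbb O})\to B^\Lambda$ extends to a linear map $q\colon B\to B^\Lambda$ with dense range, $(q(b)\mid q(c))_A=\Lambda(b^*c)$, $b\cdot q(c)=q(bc)$ and $q(b)\cdot a=q(b\,\alpha^*(a))$. -/

import Mathlib

open scoped ZeroAtInfty ComplexOrder ComplexConjugate TensorProduct CompactlySupported
open UniformSpace

/-- A pre-`C₀(W)`-`C₀(Y)`-correspondence on a complex vector space `V`: a right `C₀(Y)`-module with
a positive semidefinite `C₀(Y)`-valued inner product (conjugate-linear in the first variable),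
together with a left action of `C₀(W)` by adjointable module operators. -/
structure PreCorrespondence (W Y V : Type*) [TopologicalSpace W] [TopologicalSpace Y]
    [AddCommGroup V] [Module ℂ V] where
  /-- the left action `a · x` -/
  left : C₀(W, ℂ) →ₗ[ℂ] V →ₗ[ℂ] V
  /-- the right action, `right b x = x · b` -/
  right : C₀(Y, ℂ) →ₗ[ℂ] V →ₗ[ℂ] V
  /-- the inner product `(x ∣ y)` -/
  ip : V →ₗ⋆[ℂ] V →ₗ[ℂ] C₀(Y, ℂ)
  ip_star : ∀ x y, star (ip x y) = ip y x
  ip_nonneg : ∀ x u, 0 ≤ ip x x u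
  ip_right : ∀ x y b, ip x (right b y) = ip x y * b
  right_mul : ∀ b c x, right (b * c) x = right c (right b x)
  left_mul : ∀ a c x, left (a * c) x = left a (left c x)
  ip_left : ∀ a x y, ip (left a x) y = ip x (left (star a) y)
  left_right : ∀ a b x, left a (right b x) = right b (left a x)

/-- A `C₀(W)`-`C₀(Y)`-correspondence: a pre-correspondence which is complete in the norm
`‖x‖ = ‖(x ∣ x)‖ ^ (1/2)` (a norm, so that the inner product is definite). -/
structure Correspondence (W Y X : Type*) [TopologicalSpace W] [TopologicalSpace Y]
    [NormedAddCommGroup X] [NormedSpace ℂ X] extends PreCorrespondence W Y X where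
  norm_sq : ∀ x, ‖x‖ ^ 2 = ‖ip x x‖
  complete : CompleteSpace X

/-- Two `C₀(W)`-`C₀(Y)`-correspondences are isomorphic if there is a linear bijection between them
that preserves the inner products and intertwines the left and the right actions. -/
def Correspondence.IsIsomorphic {W Y X X' : Type*} [TopologicalSpace W] [TopologicalSpace Y]
    [NormedAddCommGroup X] [NormedSpace ℂ X] [NormedAddCommGroup X'] [NormedSpace ℂ X']
    (P : Correspondence W Y X) (Q : Correspondence W Y X') : Prop :=
  ∃ β : X ≃ₗ[ℂ] X', (∀ x y, Q.ip (β x) (β y) = P.ip x y) ∧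
    (∀ x b, β (P.right b x) = Q.right b (β x)) ∧ (∀ a x, β (P.left a x) = Q.left a (β x))

namespace PreCorrespondence

variable {W Y V : Type*} [TopologicalSpace W] [TopologicalSpace Y] [AddCommGroup V] [Module ℂ V]

/-- The vector space `V`, to be equipped with the seminorm `‖x‖ = ‖(x ∣ x)‖ ^ (1/2)`. -/
def Carrier (_P : PreCorrespondence W Y V) : Type _ := V

variable (P : PreCorrespondence W Y V)

instance : AddCommGroup P.Carrier := inferInstanceAs (AddCommGroup V)

instance : Module ℂ P.Carrier := inferInstanceAs (Module ℂ V)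

/-- The identity map from `V` to the seminormed space `P.Carrier`. -/
def toCarrier : V ≃ₗ[ℂ] P.Carrier := LinearEquiv.refl ℂ V

theorem ip_star_apply (x y : V) (u : Y) : conj (P.ip x y u) = P.ip y x u := by
  rw [← P.ip_star x y]; rfl

theorem norm_ip_apply_sq_le (x y : V) (u : Y) :
    ‖P.ip x y u‖ * ‖P.ip x y u‖ ≤ ‖P.ip x x u‖ * ‖P.ip y y u‖ := by
  let core : PreInnerProductSpace.Core ℂ V :=
    { inner := fun x y => P.ip x y u
      conj_inner_symm := fun x y => P.ip_star_apply y x u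
      re_inner_nonneg := fun x => (Complex.nonneg_iff.1 (P.ip_nonneg x u)).1
      add_left := fun x y z => by simp
      smul_left := fun x y r => by simp }
  have h := @InnerProductSpace.Core.inner_mul_inner_self_le ℂ V _ _ _ core x y
  change ‖P.ip x y u‖ * ‖P.ip y x u‖ ≤ (P.ip x x u).re * (P.ip y y u).re at h
  rw [← P.ip_star_apply x y u, RCLike.norm_conj] at h
  exact h.trans (mul_le_mul (Complex.re_le_norm _) (Complex.re_le_norm _)
    (Complex.nonneg_iff.1 (P.ip_nonneg y u)).1 (norm_nonneg _))

theorem norm_apply_le (f : C₀(Y, ℂ)) (u : Y) : ‖f u‖ ≤ ‖f‖ :=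
  f.toBCF.norm_coe_le_norm u

theorem norm_le_of_forall (f : C₀(Y, ℂ)) {C : ℝ} (hC : 0 ≤ C) (h : ∀ u, ‖f u‖ ≤ C) : ‖f‖ ≤ C :=
  (BoundedContinuousFunction.norm_le (f := f.toBCF) hC).2 h

theorem norm_ip_le (x y : V) : ‖P.ip x y‖ ≤ √‖P.ip x x‖ * √‖P.ip y y‖ := by
  refine norm_le_of_forall _ (by positivity) fun u => ?_
  rw [← Real.sqrt_mul (norm_nonneg _)]
  refine Real.le_sqrt_of_sq_le ?_
  rw [sq]
  exact (P.norm_ip_apply_sq_le x y u).trans (mul_le_mul (norm_apply_le _ u) (norm_apply_le _ u)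
    (norm_nonneg _) (norm_nonneg _))

noncomputable instance : Norm P.Carrier :=
  ⟨fun x => √‖P.ip (P.toCarrier.symm x) (P.toCarrier.symm x)‖⟩

theorem norm_def (x : P.Carrier) : ‖x‖ = √‖P.ip (P.toCarrier.symm x) (P.toCarrier.symm x)‖ := rfl

theorem core : SeminormedSpace.Core ℂ P.Carrier where
  norm_nonneg x := Real.sqrt_nonneg _
  norm_smul c x := by
    rw [norm_def, norm_def, map_smul]
    set v := P.toCarrier.symm x
    have : P.ip (c • v) (c • v) = (conj c * c) • P.ip v v := by
      simp [smul_smul, mul_comm]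
    rw [this, norm_smul, norm_mul, RCLike.norm_conj, Real.sqrt_mul (by positivity),
      Real.sqrt_mul_self (norm_nonneg _)]
  norm_triangle x y := by
    refine Real.sqrt_le_iff.2 ⟨by rw [norm_def, norm_def]; positivity, ?_⟩
    rw [norm_def, norm_def, map_add]
    set v := P.toCarrier.symm x
    set w := P.toCarrier.symm y
    have h : P.ip (v + w) (v + w) = P.ip v v + P.ip v w + (P.ip w v + P.ip w w) := by
      simp only [map_add, LinearMap.add_apply]; abel
    have h1 := P.norm_ip_le v w
    have h2 := P.norm_ip_le w v
    have h3 := norm_add₃_le (a := P.ip v v) (b := P.ip v w) (c := P.ip w v + P.ip w w)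
    have h4 := norm_add_le (P.ip w v) (P.ip w w)
    have h5 := Real.mul_self_sqrt (norm_nonneg (P.ip v v))
    have h6 := Real.mul_self_sqrt (norm_nonneg (P.ip w w))
    rw [h]
    nlinarith

noncomputable instance : SeminormedAddCommGroup P.Carrier := SeminormedAddCommGroup.ofCore P.core

noncomputable instance : NormedSpace ℂ P.Carrier where
  norm_smul_le c x := (P.core.norm_smul c x).le

theorem norm_toCarrier (v : V) : ‖P.toCarrier v‖ = √‖P.ip v v‖ := by
  rw [norm_def, LinearEquiv.symm_apply_apply]

theorem norm_sq_toCarrier (v : V) : ‖P.toCarrier v‖ ^ 2 = ‖P.ip v v‖ := by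
  rw [norm_toCarrier, Real.sq_sqrt (norm_nonneg _)]

theorem right_left (b : C₀(Y, ℂ)) (x y : V) : P.ip (P.right b x) y = star b * P.ip x y := by
  rw [← P.ip_star, P.ip_right, ← P.ip_star x y]
  ext u
  simp [mul_comm]

theorem norm_right_le (b : C₀(Y, ℂ)) (v : V) :
    ‖P.toCarrier (P.right b v)‖ ≤ ‖b‖ * ‖P.toCarrier v‖ := by
  rw [norm_toCarrier]
  refine Real.sqrt_le_iff.2 ⟨by positivity, ?_⟩
  rw [mul_pow, norm_sq_toCarrier, P.ip_right, P.right_left]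
  refine (norm_mul_le _ _).trans ?_
  have := norm_mul_le (star b) (P.ip v v)
  have hs : ‖star b‖ = ‖b‖ := norm_star b
  rw [hs] at this
  nlinarith [norm_nonneg b]

/-- The function `(‖a‖ ^ 2 - |a| ^ 2) ^ (1/2) - ‖a‖`. -/
noncomputable def defect (a : C₀(W, ℂ)) : C₀(W, ℂ) where
  toFun w := ((√(‖a‖ ^ 2 - ‖a w‖ ^ 2) - ‖a‖ : ℝ) : ℂ)
  continuous_toFun := by fun_prop
  zero_at_infty' := by
    have h : Filter.Tendsto (fun w => ‖a w‖) (Filter.cocompact W) (nhds 0) := by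
      simpa using a.zero_at_infty'.norm
    have h2 : Filter.Tendsto (fun t : ℝ => ((√(‖a‖ ^ 2 - t ^ 2) - ‖a‖ : ℝ) : ℂ)) (nhds 0)
        (nhds 0) := by
      have : Continuous (fun t : ℝ => ((√(‖a‖ ^ 2 - t ^ 2) - ‖a‖ : ℝ) : ℂ)) := by fun_prop
      simpa [Real.sqrt_sq (norm_nonneg a)] using this.tendsto 0
    exact h2.comp h

theorem defect_spec (a : C₀(W, ℂ)) :
    star (defect a) * defect a + (2 * ‖a‖ : ℂ) • defect a = - (star a * a) := by
  ext w
  have h : 0 ≤ ‖a‖ ^ 2 - ‖a w‖ ^ 2 := by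
    have := norm_apply_le a w
    nlinarith [norm_nonneg (a w)]
  have h1 : conj (a w) * a w = ((‖a w‖ ^ 2 : ℝ) : ℂ) := by
    rw [Complex.conj_mul']; norm_cast
  change conj (((√(‖a‖ ^ 2 - ‖a w‖ ^ 2) - ‖a‖ : ℝ) : ℂ))
    * ((√(‖a‖ ^ 2 - ‖a w‖ ^ 2) - ‖a‖ : ℝ) : ℂ)
    + (2 * ‖a‖ : ℂ) * ((√(‖a‖ ^ 2 - ‖a w‖ ^ 2) - ‖a‖ : ℝ) : ℂ) = - (conj (a w) * a w)
  rw [h1, Complex.conj_ofReal]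
  norm_cast
  nlinarith [Real.sq_sqrt h]

theorem star_defect (a : C₀(W, ℂ)) : star (defect a) = defect a := by
  ext w
  exact Complex.conj_ofReal _

theorem norm_left_le (a : C₀(W, ℂ)) (v : V) :
    ‖P.toCarrier (P.left a v)‖ ≤ ‖a‖ * ‖P.toCarrier v‖ := by
  rw [norm_toCarrier]
  refine Real.sqrt_le_iff.2 ⟨by positivity, ?_⟩
  rw [mul_pow, norm_sq_toCarrier]
  refine norm_le_of_forall _ (by positivity) fun u => ?_
  set d := defect a
  have key : P.ip ((‖a‖ : ℂ) • v + P.left d v) ((‖a‖ : ℂ) • v + P.left d v)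
      = ((‖a‖ ^ 2 : ℝ) : ℂ) • P.ip v v - P.ip (P.left a v) (P.left a v) := by
    have e1 : P.ip (P.left d v) (P.left d v) = P.ip v (P.left (star d * d) v) := by
      rw [P.ip_left, P.left_mul]
    have e2 : P.ip (P.left a v) (P.left a v) = P.ip v (P.left (star a * a) v) := by
      rw [P.ip_left, P.left_mul]
    have e3 : P.ip (P.left d v) v = P.ip v (P.left d v) := by
      rw [P.ip_left, star_defect]
    have e4 : P.ip v (P.left (star d * d) v) + (2 * ‖a‖ : ℂ) • P.ip v (P.left d v)
        = - P.ip v (P.left (star a * a) v) := by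
      have := congrArg (fun f => P.ip v (P.left f v)) (defect_spec a)
      simpa using this
    simp only [map_add, LinearMap.add_apply, map_smulₛₗ, LinearMap.smul_apply, e1, e2, e3,
      Complex.conj_ofReal, RingHom.id_apply]
    rw [sub_eq_add_neg, ← e4]
    push_cast
    module
  have h1 := P.ip_nonneg ((‖a‖ : ℂ) • v + P.left d v) u
  rw [key] at h1
  have h2 : P.ip (P.left a v) (P.left a v) u ≤ ((‖a‖ ^ 2 : ℝ) : ℂ) * P.ip v v u := by
    simpa using h1
  have h3 := CStarAlgebra.norm_le_norm_of_nonneg_of_le (P.ip_nonneg (P.left a v) u) h2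
  refine h3.trans ?_
  rw [norm_mul, Complex.norm_real, norm_pow, norm_norm]
  gcongr
  exact norm_apply_le _ u

/-- The left action as bounded operators. -/
noncomputable def leftL (a : C₀(W, ℂ)) : P.Carrier →L[ℂ] P.Carrier :=
  ((P.toCarrier : V →ₗ[ℂ] P.Carrier) ∘ₗ P.left a ∘ₗ (P.toCarrier.symm : P.Carrier →ₗ[ℂ] V)).mkContinuous
    ‖a‖ fun x => P.norm_left_le a (P.toCarrier.symm x)

/-- The right action as bounded operators. -/
noncomputable def rightL (b : C₀(Y, ℂ)) : P.Carrier →L[ℂ] P.Carrier :=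
  ((P.toCarrier : V →ₗ[ℂ] P.Carrier) ∘ₗ P.right b ∘ₗ (P.toCarrier.symm : P.Carrier →ₗ[ℂ] V)).mkContinuous
    ‖b‖ fun x => P.norm_right_le b (P.toCarrier.symm x)

/-- The inner product with a fixed vector as a bounded map. -/
noncomputable def ipL (v : V) : P.Carrier →L[ℂ] C₀(Y, ℂ) :=
  ((P.ip v) ∘ₗ (P.toCarrier.symm : P.Carrier →ₗ[ℂ] V)).mkContinuous
    ‖P.toCarrier v‖ fun x => P.norm_ip_le v (P.toCarrier.symm x)

theorem ipL_apply (v w : V) : P.ipL v (P.toCarrier w) = P.ip v w := rfl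

/-- The inner product, extended to the completion in the second variable. -/
noncomputable def ipR : P.Carrier →ₗ⋆[ℂ] Completion P.Carrier →L[ℂ] C₀(Y, ℂ) where
  toFun x := (P.ipL (P.toCarrier.symm x)).fromCompletion
  map_add' x y := ContinuousLinearMap.fromCompletion_unique _ _ fun e => by
    obtain ⟨w, rfl⟩ := P.toCarrier.surjective e
    rw [_root_.add_apply, ContinuousLinearMap.fromCompletion_apply_coe,
      ContinuousLinearMap.fromCompletion_apply_coe, ipL_apply, ipL_apply, ipL_apply, map_add,
      map_add, LinearMap.add_apply]
  map_smul' c x := ContinuousLinearMap.fromCompletion_unique _ _ fun e => by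
    obtain ⟨w, rfl⟩ := P.toCarrier.surjective e
    rw [_root_.smul_apply, ContinuousLinearMap.fromCompletion_apply_coe,
      ipL_apply, ipL_apply, map_smul, map_smulₛₗ, LinearMap.smul_apply]

theorem norm_ipR_le (x : P.Carrier) : ‖P.ipR x‖ ≤ 1 * ‖x‖ := by
  refine ContinuousLinearMap.opNorm_le_bound _ (by positivity) fun y => ?_
  induction y using Completion.induction_on with
  | hp => exact isClosed_le (by fun_prop) (by fun_prop)
  | ih y =>
    change ‖(P.ipL (P.toCarrier.symm x)).fromCompletion (y : Completion P.Carrier)‖ ≤ _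
    rw [ContinuousLinearMap.fromCompletion_apply_coe, one_mul, Completion.norm_coe]
    exact P.norm_ip_le (P.toCarrier.symm x) (P.toCarrier.symm y)

/-- The map `ipR` as a bounded map. -/
noncomputable def ipM : P.Carrier →L⋆[ℂ] Completion P.Carrier →L[ℂ] C₀(Y, ℂ) :=
  LinearMap.mkContinuous (𝕜 := ℂ) (𝕜₂ := ℂ) (σ := starRingEnd ℂ) (E := P.Carrier)
    (F := Completion P.Carrier →L[ℂ] C₀(Y, ℂ)) P.ipR 1 P.norm_ipR_le

/-- The inner product, extended to the completion in both variables. -/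
noncomputable def ipC : Completion P.Carrier →L⋆[ℂ] Completion P.Carrier →L[ℂ] C₀(Y, ℂ) :=
  ContinuousLinearMap.fromCompletion (R₁ := ℂ) (R₂ := ℂ) (σ := starRingEnd ℂ) (α := P.Carrier)
    (β := Completion P.Carrier →L[ℂ] C₀(Y, ℂ)) P.ipM

/-- The canonical linear map from `V` to its completion. -/
noncomputable def ι : V →ₗ[ℂ] Completion P.Carrier where
  toFun v := (P.toCarrier v : Completion P.Carrier)
  map_add' v w := by rw [map_add, Completion.coe_add]
  map_smul' c v := by rw [map_smul, Completion.coe_smul]; rfl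

theorem norm_sq_ι (v : V) : ‖P.ι v‖ ^ 2 = ‖P.ip v v‖ := by
  rw [← norm_sq_toCarrier]
  exact congrArg (· ^ 2) (Completion.norm_coe (P.toCarrier v))

theorem denseRange_ι : DenseRange P.ι :=
  Completion.denseRange_coe.comp P.toCarrier.surjective.denseRange (Completion.continuous_coe _)

theorem induction_ι {p : Completion P.Carrier → Prop} (x : Completion P.Carrier)
    (hp : IsClosed {x | p x}) (h : ∀ v, p (P.ι v)) : p x :=
  P.denseRange_ι.induction_on x hp h

theorem induction_ι₂ {p : Completion P.Carrier → Completion P.Carrier → Prop}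
    (x y : Completion P.Carrier)
    (hp : IsClosed {z : Completion P.Carrier × Completion P.Carrier | p z.1 z.2})
    (h : ∀ v w, p (P.ι v) (P.ι w)) : p x y :=
  P.denseRange_ι.induction_on₂ hp h x y

theorem ipC_ι (v w : V) : P.ipC (P.ι v) (P.ι w) = P.ip v w := by
  change P.ipC ((P.toCarrier v : P.Carrier) : Completion P.Carrier) _ = _
  rw [ipC, ContinuousLinearMap.fromCompletion_apply_coe]
  exact ContinuousLinearMap.fromCompletion_apply_coe _ _

theorem continuous_ipC {T : Type*} [TopologicalSpace T] {f g : T → Completion P.Carrier}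
    (hf : Continuous f) (hg : Continuous g) : Continuous fun t => P.ipC (f t) (g t) :=
  (P.ipC.continuous.comp hf).clm_apply hg

theorem leftL_ι (a : C₀(W, ℂ)) (v : V) : (P.leftL a).completion (P.ι v) = P.ι (P.left a v) :=
  ContinuousLinearMap.completion_apply_coe _ _

theorem rightL_ι (b : C₀(Y, ℂ)) (v : V) : (P.rightL b).completion (P.ι v) = P.ι (P.right b v) :=
  ContinuousLinearMap.completion_apply_coe _ _

theorem continuous_eval (u : Y) : Continuous fun f : C₀(Y, ℂ) => f u := by
  have : LipschitzWith 1 fun f : C₀(Y, ℂ) => f u := LipschitzWith.of_dist_le_mul fun f g => by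
    rw [NNReal.coe_one, one_mul, dist_eq_norm, dist_eq_norm]
    exact norm_apply_le (f - g) u
  exact this.continuous

/-- The left action, extended to the completion. -/
noncomputable def leftC : C₀(W, ℂ) →ₗ[ℂ] Completion P.Carrier →ₗ[ℂ] Completion P.Carrier where
  toFun a := ((P.leftL a).completion : Completion P.Carrier →ₗ[ℂ] Completion P.Carrier)
  map_add' a c := LinearMap.ext fun x => by
    change (P.leftL (a + c)).completion x = (P.leftL a).completion x + (P.leftL c).completion x
    induction x using P.induction_ι with
    | hp =>
      exact isClosed_eq (ContinuousLinearMap.continuous _)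
        ((ContinuousLinearMap.continuous _).add (ContinuousLinearMap.continuous _))
    | h v =>
      rw [leftL_ι, leftL_ι, leftL_ι, map_add, LinearMap.add_apply, map_add]
  map_smul' k a := LinearMap.ext fun x => by
    change (P.leftL (k • a)).completion x = k • (P.leftL a).completion x
    induction x using P.induction_ι with
    | hp =>
      exact isClosed_eq (ContinuousLinearMap.continuous _)
        ((ContinuousLinearMap.continuous _).const_smul k)
    | h v =>
      rw [leftL_ι, leftL_ι, map_smul, LinearMap.smul_apply, map_smul]

/-- The right action, extended to the completion. -/
noncomputable def rightC : C₀(Y, ℂ) →ₗ[ℂ] Completion P.Carrier →ₗ[ℂ] Completion P.Carrier where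
  toFun b := ((P.rightL b).completion : Completion P.Carrier →ₗ[ℂ] Completion P.Carrier)
  map_add' b c := LinearMap.ext fun x => by
    change (P.rightL (b + c)).completion x = (P.rightL b).completion x + (P.rightL c).completion x
    induction x using P.induction_ι with
    | hp =>
      exact isClosed_eq (ContinuousLinearMap.continuous _)
        ((ContinuousLinearMap.continuous _).add (ContinuousLinearMap.continuous _))
    | h v =>
      rw [rightL_ι, rightL_ι, rightL_ι, map_add, LinearMap.add_apply, map_add]
  map_smul' k b := LinearMap.ext fun x => by
    change (P.rightL (k • b)).completion x = k • (P.rightL b).completion x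
    induction x using P.induction_ι with
    | hp =>
      exact isClosed_eq (ContinuousLinearMap.continuous _)
        ((ContinuousLinearMap.continuous _).const_smul k)
    | h v =>
      rw [rightL_ι, rightL_ι, map_smul, LinearMap.smul_apply, map_smul]

theorem continuous_leftC (a : C₀(W, ℂ)) : Continuous (P.leftC a) :=
  (P.leftL a).completion.continuous

theorem continuous_rightC (b : C₀(Y, ℂ)) : Continuous (P.rightC b) :=
  (P.rightL b).completion.continuous

theorem leftC_ι (a : C₀(W, ℂ)) (v : V) : P.leftC a (P.ι v) = P.ι (P.left a v) := P.leftL_ι a v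

theorem rightC_ι (b : C₀(Y, ℂ)) (v : V) : P.rightC b (P.ι v) = P.ι (P.right b v) := P.rightL_ι b v

/-- The completion of a pre-correspondence (after the vectors of length zero are divided out): all
operations are the continuous extensions of those on `V`. -/
noncomputable def completion : Correspondence W Y (Completion P.Carrier) where
  left := P.leftC
  right := P.rightC
  ip :=
    { toFun := fun x => (P.ipC x : Completion P.Carrier →ₗ[ℂ] C₀(Y, ℂ))
      map_add' := fun x y => by rw [map_add]; rfl
      map_smul' := fun k x => by rw [map_smulₛₗ]; rfl }
  ip_star x y := by
    change star (P.ipC x y) = P.ipC y x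
    induction x, y using P.induction_ι₂ with
    | hp =>
      exact isClosed_eq
          (continuous_star.comp (P.continuous_ipC continuous_fst continuous_snd))
          (P.continuous_ipC continuous_snd continuous_fst)
    | h v w =>
      rw [ipC_ι, ipC_ι, P.ip_star]
  ip_nonneg x u := by
    change 0 ≤ P.ipC x x u
    induction x using P.induction_ι with
    | hp =>
      exact isClosed_le continuous_const
          ((continuous_eval u).comp (P.continuous_ipC continuous_id continuous_id))
    | h v =>
      rw [ipC_ι]
      exact P.ip_nonneg v u
  ip_right x y b := by
    change P.ipC x (P.rightC b y) = P.ipC x y * b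
    induction x, y using P.induction_ι₂ with
    | hp =>
      exact isClosed_eq
          (P.continuous_ipC continuous_fst ((P.continuous_rightC b).comp continuous_snd))
          ((P.continuous_ipC continuous_fst continuous_snd).mul continuous_const)
    | h v w =>
      rw [rightC_ι, ipC_ι, ipC_ι, P.ip_right]
  right_mul b c x := by
    induction x using P.induction_ι with
    | hp =>
      exact isClosed_eq (P.continuous_rightC _)
          ((P.continuous_rightC c).comp (P.continuous_rightC b))
    | h v =>
      rw [rightC_ι, rightC_ι, rightC_ι, P.right_mul]
  left_mul a c x := by
    induction x using P.induction_ι with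
    | hp =>
      exact isClosed_eq (P.continuous_leftC _)
          ((P.continuous_leftC a).comp (P.continuous_leftC c))
    | h v =>
      rw [leftC_ι, leftC_ι, leftC_ι, P.left_mul]
  ip_left a x y := by
    change P.ipC (P.leftC a x) y = P.ipC x (P.leftC (star a) y)
    induction x, y using P.induction_ι₂ with
    | hp =>
      exact isClosed_eq
          (P.continuous_ipC ((P.continuous_leftC a).comp continuous_fst) continuous_snd)
          (P.continuous_ipC continuous_fst ((P.continuous_leftC _).comp continuous_snd))
    | h v w =>
      rw [leftC_ι, leftC_ι, ipC_ι, ipC_ι, P.ip_left]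
  left_right a b x := by
    induction x using P.induction_ι with
    | hp =>
      exact isClosed_eq ((P.continuous_leftC a).comp (P.continuous_rightC b))
          ((P.continuous_rightC b).comp (P.continuous_leftC a))
    | h v =>
      rw [leftC_ι, rightC_ι, rightC_ι, leftC_ι, P.left_right]
  norm_sq x := by
    change ‖x‖ ^ 2 = ‖P.ipC x x‖
    induction x using P.induction_ι with
    | hp =>
      exact isClosed_eq (by fun_prop)
          (P.continuous_ipC continuous_id continuous_id).norm
    | h v =>
      rw [ipC_ι, norm_sq_ι]
  complete := inferInstance

theorem completion_left_ι (a : C₀(W, ℂ)) (v : V) :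
    P.completion.left a (P.ι v) = P.ι (P.left a v) := P.leftC_ι a v

theorem completion_right_ι (b : C₀(Y, ℂ)) (v : V) :
    P.completion.right b (P.ι v) = P.ι (P.right b v) := P.rightC_ι b v

theorem completion_ip_ι (v w : V) : P.completion.ip (P.ι v) (P.ι w) = P.ip v w := P.ipC_ι v w

end PreCorrespondence

section GramRoot

open scoped Matrix.Norms.L2Operator MatrixOrder

/-- A continuous family of positive matrices, vanishing at infinity, has a continuous square root
that vanishes at infinity. -/
theorem exists_sqrt_of_posSemidef {Z ι : Type*} [TopologicalSpace Z] [Fintype ι] [DecidableEq ι]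
    (g : ι → ι → C₀(Z, ℂ)) (hg : ∀ z, (Matrix.of fun i j => g i j z).PosSemidef) :
    ∃ s : ι → ι → C₀(Z, ℂ), ∀ i j, g i j = ∑ k, star (s k i) * s k j := by
  let G : Z → Matrix ι ι ℂ := fun z => Matrix.of fun i j => g i j z
  have hG0 : ∀ z, 0 ≤ G z := fun z => (hg z).nonneg
  have hGc : Continuous G := continuous_matrix fun i j => (g i j).continuous
  have hGt : Filter.Tendsto G (Filter.cocompact Z) (nhds 0) := by
    refine tendsto_pi_nhds.2 fun i => tendsto_pi_nhds.2 fun j => ?_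
    exact (g i j).zero_at_infty'
  have hsc : Continuous fun z => CFC.sqrt (G z) :=
    CFC.continuousOn_sqrt.comp_continuous hGc hG0
  have hst : Filter.Tendsto (fun z => CFC.sqrt (G z)) (Filter.cocompact Z) (nhds 0) := by
    have h := (CFC.continuousOn_sqrt (A := Matrix ι ι ℂ)).continuousWithinAt (x := 0) (le_refl (0 : Matrix ι ι ℂ))
    have h' := h.tendsto.comp (tendsto_nhdsWithin_iff.2 ⟨hGt, Filter.Eventually.of_forall hG0⟩)
    have h0 : CFC.sqrt (0 : Matrix ι ι ℂ) = 0 := CFC.sqrt_zero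
    rw [h0] at h'
    exact h'
  refine ⟨fun i j => ⟨⟨fun z => CFC.sqrt (G z) i j, hsc.matrix_elem i j⟩, ?_⟩, fun i j => ?_⟩
  · exact (((continuous_id.matrix_elem i j).tendsto (0 : Matrix ι ι ℂ)).comp hst)
  · ext z
    have h1 : CFC.sqrt (G z) * CFC.sqrt (G z) = G z := CFC.sqrt_mul_sqrt_self (G z) (hG0 z)
    have h2 : (CFC.sqrt (G z)).conjTranspose = CFC.sqrt (G z) :=
      (CFC.sqrt_nonneg (G z)).isSelfAdjoint
    have h3 : g i j z = ((CFC.sqrt (G z)).conjTranspose * CFC.sqrt (G z)) i j := by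
      rw [h2, h1]; rfl
    rw [h3, Matrix.mul_apply]
    have h4 : ∀ F : ι → C₀(Z, ℂ), (∑ k, F k) z = ∑ k, F k z := fun F =>
      map_sum (AddMonoidHom.mk' (fun f : C₀(Z, ℂ) => f z) fun _ _ => rfl) F Finset.univ
    rw [h4]
    rfl

end GramRoot

namespace PreCorrespondence

variable {W Z Y V₁ V₂ : Type*} [TopologicalSpace W] [TopologicalSpace Z] [TopologicalSpace Y]
  [AddCommGroup V₁] [Module ℂ V₁] [AddCommGroup V₂] [Module ℂ V₂]
  (Q : PreCorrespondence W Z V₁) (P : PreCorrespondence Z Y V₂)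

/-- The inner product on the algebraic tensor product,
`(x₁ ⊗ y₁ ∣ x₂ ⊗ y₂) = (y₁ ∣ (x₁ ∣ x₂) · y₂)`. -/
noncomputable def tensorIp : V₁ ⊗[ℂ] V₂ →ₗ⋆[ℂ] V₁ ⊗[ℂ] V₂ →ₗ[ℂ] C₀(Y, ℂ) :=
  TensorProduct.lift (LinearMap.mk₂'ₛₗ (starRingEnd ℂ) (starRingEnd ℂ)
    (fun x y => TensorProduct.lift ((P.left ∘ₗ Q.ip x).compr₂ (P.ip y)))
    (fun x x' y => TensorProduct.ext' fun x₂ y₂ => by simp)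
    (fun c x y => TensorProduct.ext' fun x₂ y₂ => by simp)
    (fun x y y' => TensorProduct.ext' fun x₂ y₂ => by simp)
    (fun c x y => TensorProduct.ext' fun x₂ y₂ => by simp))

theorem tensorIp_tmul (x₁ x₂ : V₁) (y₁ y₂ : V₂) :
    Q.tensorIp P (x₁ ⊗ₜ y₁) (x₂ ⊗ₜ y₂) = P.ip y₁ (P.left (Q.ip x₁ x₂) y₂) := rfl

theorem tensorIp_nonneg (ξ : V₁ ⊗[ℂ] V₂) (u : Y) : 0 ≤ Q.tensorIp P ξ ξ u := by
  classical
  obtain ⟨S, rfl⟩ := TensorProduct.exists_finset ξ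
  rw [← Finset.sum_coe_sort]
  obtain ⟨s, hs⟩ := exists_sqrt_of_posSemidef (fun i j : S => Q.ip i.1.1 j.1.1) (fun z => by
    refine Matrix.PosSemidef.of_dotProduct_mulVec_nonneg ?_ ?_
    · ext i j
      exact Q.ip_star_apply _ _ _
    · intro c
      have h := Q.ip_nonneg (∑ i, c i • i.1.1) z
      have h4 : ∀ F : S → C₀(Z, ℂ), (∑ k, F k) z = ∑ k, F k z := fun F =>
        map_sum (AddMonoidHom.mk' (fun f : C₀(Z, ℂ) => f z) fun _ _ => rfl) F Finset.univ
      convert h using 1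
      simp only [map_sum, LinearMap.sum_apply, h4, map_smulₛₗ, LinearMap.smul_apply,
        ZeroAtInftyContinuousMap.smul_apply, dotProduct, Matrix.mulVec, Matrix.of_apply,
        Finset.mul_sum, RingHom.id_apply, smul_eq_mul, Pi.star_apply, RCLike.star_def]
      rw [Finset.sum_comm]
      refine Finset.sum_congr rfl fun i _ => Finset.sum_congr rfl fun j _ => ?_
      ring)
  have key : Q.tensorIp P (∑ i : S, i.1.1 ⊗ₜ i.1.2) (∑ i : S, i.1.1 ⊗ₜ i.1.2)
      = ∑ k, P.ip (∑ i : S, P.left (s k i) i.1.2) (∑ i : S, P.left (s k i) i.1.2) := by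
    simp only [map_sum, LinearMap.sum_apply, tensorIp_tmul, hs, P.ip_left, P.left_mul]
    exact (Finset.sum_congr rfl fun _ _ => Finset.sum_comm).trans Finset.sum_comm
  rw [key]
  have h4 : ∀ F : S → C₀(Y, ℂ), (∑ k, F k) u = ∑ k, F k u := fun F =>
    map_sum (AddMonoidHom.mk' (fun f : C₀(Y, ℂ) => f u) fun _ _ => rfl) F Finset.univ
  rw [h4]
  exact Finset.sum_nonneg fun k _ => P.ip_nonneg _ u

/-- The algebraic tensor product of two pre-correspondences. -/
noncomputable def algTensor : PreCorrespondence W Y (V₁ ⊗[ℂ] V₂) where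
  left := LinearMap.rTensorHom V₂ ∘ₗ Q.left
  right := LinearMap.lTensorHom V₁ ∘ₗ P.right
  ip := Q.tensorIp P
  ip_star x y := by
    induction x with
    | zero => simp
    | add x x' h h' => simp [h, h']
    | tmul x₁ y₁ =>
      induction y with
      | zero => simp
      | add y y' h h' => simp [h, h']
      | tmul x₂ y₂ =>
        rw [tensorIp_tmul, tensorIp_tmul, P.ip_star, P.ip_left, Q.ip_star]
  ip_nonneg := Q.tensorIp_nonneg P
  ip_right x y b := by
    induction x with
    | zero => simp
    | add x x' h h' => rw [map_add, LinearMap.add_apply, LinearMap.add_apply, h, h', add_mul]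
    | tmul x₁ y₁ =>
      induction y with
      | zero => simp
      | add y y' h h' => rw [map_add, map_add, map_add, h, h', add_mul]
      | tmul x₂ y₂ =>
        change Q.tensorIp P (x₁ ⊗ₜ y₁) (x₂ ⊗ₜ P.right b y₂) = _
        rw [tensorIp_tmul, tensorIp_tmul, P.left_right, P.ip_right]
  right_mul b c x := by
    induction x with
    | zero => simp
    | add x x' h h' => rw [map_add, map_add, map_add, h, h']
    | tmul x y =>
      change x ⊗ₜ P.right (b * c) y = x ⊗ₜ[ℂ] P.right c (P.right b y)
      rw [P.right_mul]
  left_mul a c x := by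
    induction x with
    | zero => simp
    | add x x' h h' => rw [map_add, map_add, map_add, h, h']
    | tmul x y =>
      change Q.left (a * c) x ⊗ₜ y = Q.left a (Q.left c x) ⊗ₜ[ℂ] y
      rw [Q.left_mul]
  ip_left a x y := by
    induction x with
    | zero => simp
    | add x x' h h' => simp only [map_add, LinearMap.add_apply, h, h']
    | tmul x₁ y₁ =>
      induction y with
      | zero => simp
      | add y y' h h' => rw [map_add, map_add, map_add, h, h']
      | tmul x₂ y₂ =>
        change Q.tensorIp P (Q.left a x₁ ⊗ₜ y₁) (x₂ ⊗ₜ y₂)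
          = Q.tensorIp P (x₁ ⊗ₜ y₁) (Q.left (star a) x₂ ⊗ₜ y₂)
        rw [tensorIp_tmul, tensorIp_tmul, Q.ip_left]
  left_right a b x := by
    induction x with
    | zero => simp
    | add x x' h h' => rw [map_add, map_add, map_add, map_add, h, h']
    | tmul x y => rfl

/-- The interior tensor product of a `C₀(W)`-`C₀(Z)`-correspondence and a
`C₀(Z)`-`C₀(Y)`-correspondence: the completion of the algebraic tensor product in the inner product
`(x₁ ⊗ y₁ ∣ x₂ ⊗ y₂) = (y₁ ∣ (x₁ ∣ x₂) · y₂)`, modulo the vectors of length zero (these include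
all `(x · a) ⊗ y - x ⊗ (a · y)`). -/
noncomputable def tensor : Correspondence W Y (Completion (Q.algTensor P).Carrier) :=
  (Q.algTensor P).completion

end PreCorrespondence

section FibreSum

variable {M Y : Type*} [TopologicalSpace M] [TopologicalSpace Y]

/-- The function `y ↦ ∑ f e` over the fibre `s e = y`. -/
noncomputable def fibreSumFun {M Y : Type*} (s : M → Y) (f : M → ℂ) (y : Y) : ℂ := ∑ᶠ e ∈ s ⁻¹' {y}, f e

theorem finite_compact_inter_fibre [T2Space Y] {s : M → Y} (hs : IsLocalHomeomorph s) {K : Set M}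
    (hK : IsCompact K) (y : Y) : (K ∩ s ⁻¹' {y}).Finite := by
  refine (hK.inter_right (isClosed_singleton.preimage hs.continuous)).finite ?_
  refine (hs.isLocalHomeomorphOn.mono (Set.subset_univ _)).isDiscrete_of_image ?_
  have h : (s '' (K ∩ s ⁻¹' {y})).Subsingleton := by
    rintro _ ⟨a, ⟨-, ha⟩, rfl⟩ _ ⟨b, ⟨-, hb⟩, rfl⟩
    exact (Set.mem_singleton_iff.1 ha).trans (Set.mem_singleton_iff.1 hb).symm
  exact h.isDiscrete

theorem fibreSumFun_eq_sum {M Y : Type*} {s : M → Y} {K : Set M} {y : Y} (hK : (K ∩ s ⁻¹' {y}).Finite)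
    {f : M → ℂ} (hf : ∀ e, e ∉ K → f e = 0) : fibreSumFun s f y = ∑ e ∈ hK.toFinset, f e := by
  refine finsum_mem_eq_sum_of_inter_support_eq f ?_
  ext e
  simp only [Set.mem_inter_iff, Set.mem_preimage, Set.mem_singleton_iff, Function.mem_support,
    Set.Finite.coe_toFinset]
  refine ⟨fun h => ⟨⟨?_, h.1⟩, h.2⟩, fun h => ⟨h.1.2, h.2⟩⟩
  by_contra hc
  exact h.2 (hf e hc)

theorem fibreSumFun_eq_zero {M Y : Type*} {s : M → Y} {f : M → ℂ} {y : Y} (h : ∀ e, s e = y → f e = 0) :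
    fibreSumFun s f y = 0 :=
  finsum_mem_of_eqOn_zero fun e he => h e he

/-- Continuity of the sum over the fibres, for a function supported where `s` is a chart. -/
theorem continuous_fibreSumFun_of_chart [T2Space Y] {s : M → Y} (hs : Continuous s)
    (e : OpenPartialHomeomorph M Y) (he : s = e) {g : M → ℂ} (hg : Continuous g) {K : Set M}
    (hK : IsCompact K) (hKe : K ⊆ e.source) (hgK : ∀ x, x ∉ K → g x = 0) :
    Continuous (fibreSumFun s g) := by
  subst he
  have h1 : ∀ y ∈ e.target, fibreSumFun e g y = g (e.symm y) := by
    intro y hy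
    have hfin : (K ∩ e ⁻¹' {y}) ⊆ {e.symm y} := by
      rintro x ⟨hxK, hxy⟩
      rw [Set.mem_singleton_iff, ← Set.mem_singleton_iff.1 hxy, e.left_inv (hKe hxK)]
    rw [fibreSumFun_eq_sum ((Set.finite_singleton _).subset hfin) hgK]
    by_cases hx : e.symm y ∈ K
    · rw [Finset.sum_eq_single (e.symm y)]
      · intro b hb hne
        exact absurd (hfin (by simpa using hb)) hne
      · intro hn
        exact absurd (by rw [Set.Finite.mem_toFinset]; exact ⟨hx, e.right_inv hy⟩) hn
    · rw [hgK _ hx]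
      refine Finset.sum_eq_zero fun b hb => ?_
      have hb' := (Set.Finite.mem_toFinset _).1 hb
      have := hfin hb'
      rw [Set.mem_singleton_iff] at this
      exact absurd (this ▸ hb'.1) hx
  rw [continuous_iff_continuousAt]
  intro y
  by_cases hy : y ∈ e.target
  · have h2 : ContinuousAt (fun y => g (e.symm y)) y :=
      hg.continuousAt.comp (e.continuousAt_symm hy)
    refine h2.congr ?_
    filter_upwards [e.open_target.mem_nhds hy] with z hz
    exact (h1 z hz).symm
  · have hcl : IsClosed (e '' K) := (hK.image hs).isClosed
    have hyK : y ∈ (e '' K)ᶜ := by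
      rintro ⟨x, hx, rfl⟩
      exact hy (e.map_source (hKe hx))
    refine (continuousAt_const (y := (0 : ℂ))).congr ?_
    filter_upwards [hcl.isOpen_compl.mem_nhds hyK] with z hz
    refine (fibreSumFun_eq_zero fun x hx => hgK x fun hxK => hz ⟨x, hxK, hx⟩).symm

theorem continuous_fibreSumFun [T2Space M] [LocallyCompactSpace M] [T2Space Y] {s : M → Y}
    (hs : IsLocalHomeomorph s) {f : M → ℂ} (hf : Continuous f) {K : Set M} (hK : IsCompact K)
    (hfK : ∀ x, x ∉ K → f x = 0) : Continuous (fibreSumFun s f) := by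
  choose e hxe hse using hs
  obtain ⟨t, -, ht⟩ := hK.elim_nhds_subcover (fun x => (e x).source)
    fun x _ => (e x).open_source.mem_nhds (hxe x)
  obtain ⟨ρ, hρs, hρ1, -, hρc⟩ := exists_continuous_sum_one_of_isOpen_isCompact
    (n := t.card) (s := fun i => (e (t.equivFin.symm i)).source) (t := K)
    (fun i => (e _).open_source) hK (by
      intro x hx
      obtain ⟨z, hz, hxz⟩ := Set.mem_iUnion₂.1 (ht hx)
      exact Set.mem_iUnion.2 ⟨t.equivFin ⟨z, hz⟩, by simpa using hxz⟩)
  have hs' : IsLocalHomeomorph s := fun x => ⟨e x, hxe x, hse x⟩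
  have hsum : fibreSumFun s f = fun y => ∑ i, fibreSumFun s (fun x => (ρ i x : ℂ) * f x) y := by
    funext y
    have hfin := finite_compact_inter_fibre hs' hK y
    rw [fibreSumFun_eq_sum hfin hfK, Finset.sum_congr rfl fun i _ => fibreSumFun_eq_sum hfin
      (f := fun x => (ρ i x : ℂ) * f x) (fun x hx => by simp [hfK x hx]), Finset.sum_comm]
    refine Finset.sum_congr rfl fun x hx => ?_
    have hxK : x ∈ K := ((Set.Finite.mem_toFinset _).1 hx).1
    have h1 : ∑ i, ρ i x = 1 := by simpa using hρ1 hxK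
    rw [← Finset.sum_mul, ← Complex.ofReal_sum, h1, Complex.ofReal_one, one_mul]
  rw [hsum]
  refine continuous_finsetSum _ fun i _ => ?_
  refine continuous_fibreSumFun_of_chart hs'.continuous (e _) (hse (t.equivFin.symm i))
    (by fun_prop) (hρc i) (hρs i) fun x hx => ?_
  rw [image_eq_zero_of_notMem_tsupport hx]
  simp

/-- For a local homeomorphism `s : M → Y`, the linear map `C_c(M) → C_c(Y)` that sends `f` to the
function `y ↦ ∑ f e` over the fibre `s e = y`. -/
noncomputable def fibreSum [T2Space M] [LocallyCompactSpace M] [T2Space Y] (s : M → Y)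
    (hs : IsLocalHomeomorph s) : C_c(M, ℂ) →ₗ[ℂ] C_c(Y, ℂ) where
  toFun f := ⟨⟨fibreSumFun s f, continuous_fibreSumFun hs (map_continuous f) f.hasCompactSupport
      fun _ hx => image_eq_zero_of_notMem_tsupport hx⟩,
    HasCompactSupport.intro (f.hasCompactSupport.isCompact.image hs.continuous) fun _ hy =>
      fibreSumFun_eq_zero fun e he => image_eq_zero_of_notMem_tsupport fun h => hy ⟨e, h, he⟩⟩
  map_add' f g := by
    ext y
    have hc : IsCompact (tsupport f ∪ tsupport g) :=
      f.hasCompactSupport.isCompact.union g.hasCompactSupport.isCompact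
    have hfin := finite_compact_inter_fibre hs hc y
    have hf : ∀ e, e ∉ tsupport f ∪ tsupport g → f e = 0 := fun e he =>
      image_eq_zero_of_notMem_tsupport fun h => he (Or.inl h)
    have hg : ∀ e, e ∉ tsupport f ∪ tsupport g → g e = 0 := fun e he =>
      image_eq_zero_of_notMem_tsupport fun h => he (Or.inr h)
    change fibreSumFun s (f + g : C_c(M, ℂ)) y = fibreSumFun s f y + fibreSumFun s g y
    rw [fibreSumFun_eq_sum hfin hf, fibreSumFun_eq_sum hfin hg, fibreSumFun_eq_sum hfin
      (f := (f + g : C_c(M, ℂ))) (fun e he => by simp [hf e he, hg e he]), ← Finset.sum_add_distrib]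
    rfl
  map_smul' c f := by
    ext y
    have hfin := finite_compact_inter_fibre hs f.hasCompactSupport.isCompact y
    have hf : ∀ e, e ∉ tsupport f → f e = 0 := fun e he => image_eq_zero_of_notMem_tsupport he
    change fibreSumFun s (c • f : C_c(M, ℂ)) y = c * fibreSumFun s f y
    rw [fibreSumFun_eq_sum hfin hf, fibreSumFun_eq_sum hfin (f := (c • f : C_c(M, ℂ)))
      (fun e he => by simp [hf e he]), Finset.mul_sum]
    rfl

theorem fibreSum_apply [T2Space M] [LocallyCompactSpace M] [T2Space Y] (s : M → Y)
    (hs : IsLocalHomeomorph s) (f : C_c(M, ℂ)) (y : Y) :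
    fibreSum s hs f y = ∑ᶠ e ∈ s ⁻¹' {y}, f e := rfl

theorem fibreSum_nonneg [T2Space M] [LocallyCompactSpace M] [T2Space Y] (s : M → Y)
    (hs : IsLocalHomeomorph s) (f : C_c(M, ℂ)) (hf : ∀ e, 0 ≤ f e) (y : Y) :
    0 ≤ fibreSum s hs f y :=
  finsum_mem_induction (fun z : ℂ => 0 ≤ z) le_rfl (fun _ _ => add_nonneg) fun e _ => hf e

/-- Multiplication of `x ∈ C_c(M)` by `b ∘ s`, for `b ∈ C₀(Y)` and a continuous `s : M → Y`. -/
noncomputable def pullbackMul (s : C(M, Y)) : C₀(Y, ℂ) →ₗ[ℂ] C_c(M, ℂ) →ₗ[ℂ] C_c(M, ℂ) :=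
  LinearMap.mk₂ ℂ (fun b x => (b : C(Y, ℂ)).comp s • x)
    (fun b c x => by ext e; exact add_mul _ _ _)
    (fun k b x => by ext e; exact mul_assoc _ _ _)
    (fun b x y => by ext e; exact mul_add _ _ _)
    (fun k b x => by ext e; exact mul_left_comm _ _ _)

theorem pullbackMul_apply (s : C(M, Y)) (b : C₀(Y, ℂ)) (x : C_c(M, ℂ)) (e : M) :
    pullbackMul s b x e = b (s e) * x e := rfl

/-- The inner product `(x ∣ y)(v) = ∑ conj (x e) * y e` over the fibre `s e = v`. -/
noncomputable def fibreIp [T2Space M] [LocallyCompactSpace M] [T2Space Y] (s : M → Y)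
    (hs : IsLocalHomeomorph s) : C_c(M, ℂ) →ₗ⋆[ℂ] C_c(M, ℂ) →ₗ[ℂ] C₀(Y, ℂ) :=
  LinearMap.mk₂'ₛₗ (starRingEnd ℂ) (RingHom.id ℂ)
    (fun x y => (fibreSum s hs (star x * y) : C₀(Y, ℂ)))
    (fun x x' y => by rw [star_add, add_mul, map_add]; rfl)
    (fun c x y => by rw [star_smul, smul_mul_assoc, map_smul]; rfl)
    (fun x y y' => by rw [mul_add, map_add]; rfl)
    (fun c x y => by rw [mul_smul_comm, map_smul]; rfl)

theorem fibreIp_apply [T2Space M] [LocallyCompactSpace M] [T2Space Y] (s : M → Y)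
    (hs : IsLocalHomeomorph s) (x y : C_c(M, ℂ)) (v : Y) :
    fibreIp s hs x y v = ∑ᶠ e ∈ s ⁻¹' {v}, conj (x e) * y e := rfl

/-- For a continuous map `r : M → W` and a local homeomorphism `s : M → Y`, the
pre-correspondence `C_c(M)` with the operations `(a · x)(e) = a (r e) * x e`,
`(x · b)(e) = x e * b (s e)` and `(x ∣ y)(v) = ∑ conj (x e) * y e` over the fibre `s e = v`. -/
noncomputable def fibrePreCorrespondence {W : Type*} [TopologicalSpace W] [T2Space M]
    [LocallyCompactSpace M] [T2Space Y] (r : M → W) (hr : Continuous r) (s : M → Y)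
    (hs : IsLocalHomeomorph s) : PreCorrespondence W Y C_c(M, ℂ) where
  left := pullbackMul ⟨r, hr⟩
  right := pullbackMul ⟨s, hs.continuous⟩
  ip := fibreIp s hs
  ip_star x y := by
    ext v
    change conj (fibreIp s hs x y v) = fibreIp s hs y x v
    have hfin := finite_compact_inter_fibre hs x.hasCompactSupport.isCompact v
    have hx : ∀ e, e ∉ tsupport x → x e = 0 := fun e he => image_eq_zero_of_notMem_tsupport he
    change conj (fibreSumFun s (fun e => conj (x e) * y e) v)
      = fibreSumFun s (fun e => conj (y e) * x e) v
    rw [fibreSumFun_eq_sum hfin (by simp +contextual [hx]),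
      fibreSumFun_eq_sum hfin (by simp +contextual [hx]), map_sum]
    simp [mul_comm]
  ip_nonneg x v := fibreSum_nonneg s hs (star x * x) (fun e => star_mul_self_nonneg (x e)) v
  ip_right x y b := by
    ext v
    have hfin := finite_compact_inter_fibre hs x.hasCompactSupport.isCompact v
    have hx : ∀ e, e ∉ tsupport x → x e = 0 := fun e he => image_eq_zero_of_notMem_tsupport he
    change fibreSumFun s (fun e => conj (x e) * (b (s e) * y e)) v
      = fibreSumFun s (fun e => conj (x e) * y e) v * b v
    rw [fibreSumFun_eq_sum hfin (by simp +contextual [hx]),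
      fibreSumFun_eq_sum hfin (by simp +contextual [hx]), Finset.sum_mul]
    refine Finset.sum_congr rfl fun e he => ?_
    have : s e = v := ((Set.Finite.mem_toFinset _).1 he).2
    rw [this]
    ring
  right_mul b c x := by ext e; simp only [pullbackMul_apply, ZeroAtInftyContinuousMap.mul_apply]; ring
  left_mul a c x := by ext e; simp only [pullbackMul_apply, ZeroAtInftyContinuousMap.mul_apply]; ring
  ip_left a x y := by
    ext v
    refine congrArg (fun f => fibreSumFun s f v) (funext fun e => ?_)
    change conj (a (r e) * x e) * y e = conj (x e) * (conj (a (r e)) * y e)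
    rw [map_mul]
    ring
  left_right a b x := by ext e; simp only [pullbackMul_apply]; ring

end FibreSum

universe u v w

/-- A topological graph: second countable locally compact Hausdorff spaces `V` of vertices and `E` of
edges, a continuous range map `r` and a source map `s` which is a local homeomorphism. -/
structure TopologicalGraph where
  V : Type u
  E : Type v
  [topV : TopologicalSpace V]
  [t2V : T2Space V]
  [lcV : LocallyCompactSpace V]
  [scV : SecondCountableTopology V]
  [topE : TopologicalSpace E]
  [t2E : T2Space E]
  [lcE : LocallyCompactSpace E]
  [scE : SecondCountableTopology E]
  r : E → V
  s : E → V
  continuous_r : Continuous r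
  isLocalHomeomorph_s : IsLocalHomeomorph s

namespace TopologicalGraph

attribute [instance] topV t2V lcV scV topE t2E lcE scE

section Regular

variable {X Y : Type*} [TopologicalSpace X] [TopologicalSpace Y] (f : X → Y)

/-- the `f`-sources -/
def sourceSet : Set Y := (closure (Set.range f))ᶜ

/-- the `f`-finite receivers -/
def finiteSet : Set Y :=
  {y | ∃ U, IsOpen U ∧ y ∈ U ∧ IsCompact (closure U) ∧ IsCompact (f ⁻¹' closure U)}

/-- the `f`-regular set -/
def regularSet : Set Y := finiteSet f \ closure (sourceSet f)

/-- the `f`-singular set -/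
def singularSet : Set Y := (regularSet f)ᶜ

end Regular

/-- A topological graph is regular if its set of singular vertices (with respect to the range map) is
empty. -/
def IsRegular (G : TopologicalGraph.{u, v}) : Prop := singularSet G.r = ∅

variable (G : TopologicalGraph.{u, v})

/-- The `C₀(V)`-`C₀(V)`-pre-correspondence `C_c(E)` of a topological graph. -/
noncomputable def preCorrespondence : PreCorrespondence G.V G.V C_c(G.E, ℂ) :=
  fibrePreCorrespondence G.r G.continuous_r G.s G.isLocalHomeomorph_s

/-- The underlying space of the graph correspondence: the completion of `C_c(E)`. -/
abbrev GraphModule := Completion G.preCorrespondence.Carrier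

/-- The canonical map from `C_c(E)` to the graph correspondence. -/
noncomputable abbrev ι : C_c(G.E, ℂ) →ₗ[ℂ] G.GraphModule := G.preCorrespondence.ι

/-- The graph correspondence of a topological graph. -/
noncomputable def correspondence : Correspondence G.V G.V G.GraphModule :=
  G.preCorrespondence.completion

end TopologicalGraph

/-- An out-split of a topological graph: a factorisation `s = α ∘ ψ` of the source map through a locally
compact Hausdorff space `Y`, by proper surjective local homeomorphisms `α` and `ψ`. -/
structure OutSplit (G : TopologicalGraph.{u, v}) where
  Y : Type w
  [topY : TopologicalSpace Y]
  [t2Y : T2Space Y]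
  [lcY : LocallyCompactSpace Y]
  α : Y → G.V
  isProperMap_α : IsProperMap α
  surjective_α : Function.Surjective α
  isLocalHomeomorph_α : IsLocalHomeomorph α
  ψ : G.E → Y
  isProperMap_ψ : IsProperMap ψ
  surjective_ψ : Function.Surjective ψ
  isLocalHomeomorph_ψ : IsLocalHomeomorph ψ
  comp_eq : α ∘ ψ = G.s

namespace OutSplit

attribute [instance] topY t2Y lcY

variable {G : TopologicalGraph.{u, v}} (O : OutSplit.{u, v, w} G)

instance : SecondCountableTopology O.Y :=
  (O.isLocalHomeomorph_ψ.isOpenMap.isQuotientMap O.isLocalHomeomorph_ψ.continuous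
    O.surjective_ψ).secondCountableTopology O.isLocalHomeomorph_ψ.isOpenMap

/-- The fibred product of `Y` and the edge space over `α` and the range map. -/
abbrev EdgeSpace := {p : O.Y × G.E // O.α p.1 = G.r p.2}

instance : LocallyCompactSpace O.EdgeSpace :=
  (isClosed_eq (O.isLocalHomeomorph_α.continuous.comp continuous_fst)
    (G.continuous_r.comp continuous_snd)).isClosedEmbedding_subtypeVal.locallyCompactSpace

instance : SecondCountableTopology O.EdgeSpace :=
  TopologicalSpace.Subtype.secondCountableTopology _

theorem isLocalHomeomorph_snd : IsLocalHomeomorph fun p : O.EdgeSpace => p.1.2 := by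
  have hcont : Continuous fun p : O.EdgeSpace => p.1.2 := by fun_prop
  have hopen : IsOpenMap fun p : O.EdgeSpace => p.1.2 := by
    refine IsOpenMap.of_nhds_le fun p N hN => ?_
    obtain ⟨T, hT, hTN⟩ := (mem_nhds_induced _ _ _).1 (Filter.mem_map.1 hN)
    obtain ⟨A, hA, B, hB, hAB⟩ := mem_nhds_prod_iff.1 hT
    have hr : G.r ⁻¹' (O.α '' A) ∈ nhds p.1.2 := by
      refine G.continuous_r.continuousAt ?_
      rw [← p.2]
      exact O.isLocalHomeomorph_α.isOpenMap.image_mem_nhds hA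
    filter_upwards [hr, hB] with e he heB
    obtain ⟨y, hy, hye⟩ := he
    exact hTN (a := ⟨(y, e), hye⟩) (hAB ⟨hy, heB⟩)
  rw [isLocalHomeomorph_iff_isOpenEmbedding_restrict]
  intro p
  obtain ⟨c, hc, hαc⟩ := O.isLocalHomeomorph_α p.1.1
  have hU : IsOpen {q : O.EdgeSpace | q.1.1 ∈ c.source} := c.open_source.preimage (by fun_prop)
  refine ⟨{q : O.EdgeSpace | q.1.1 ∈ c.source}, hU.mem_nhds hc,
    Topology.IsOpenEmbedding.of_continuous_injective_isOpenMap
      (hcont.comp continuous_subtype_val) ?_ (hopen.domRestrict hU)⟩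
  rintro ⟨⟨⟨y, e⟩, hq⟩, hy⟩ ⟨⟨⟨y', e'⟩, hq'⟩, hy'⟩ h
  have he : e = e' := h
  subst he
  have : y = y' := c.injOn hy hy' (by rw [← hαc]; exact hq.trans hq'.symm)
  subst this
  rfl

/-- The out-split graph: vertex space `Y`, edge space the fibred product `Y ×_{α, r} E`, range map
`(y, e) ↦ y` and source map `(y, e) ↦ ψ e`. -/
def graph : TopologicalGraph.{w, max v w} where
  V := O.Y
  E := O.EdgeSpace
  r p := p.1.1
  s p := O.ψ p.1.2
  continuous_r := by fun_prop
  isLocalHomeomorph_s := O.isLocalHomeomorph_ψ.comp O.isLocalHomeomorph_snd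

/-- The map `Λ : C_c(Y) → C_c(V)`, `Λ b v = ∑ b u` over the fibre `α u = v`. -/
noncomputable def expectation : C_c(O.Y, ℂ) →ₗ[ℂ] C_c(G.V, ℂ) :=
  fibreSum O.α O.isLocalHomeomorph_α

/-- The `C₀(Y)`-`C₀(V)`-pre-correspondence `C_c(Y)` with left multiplication, right action
`b · a = b * (a ∘ α)` and inner product `(b ∣ c) = Λ (star b * c)`. -/
noncomputable def expectationPre : PreCorrespondence O.Y G.V C_c(O.Y, ℂ) :=
  fibrePreCorrespondence id continuous_id O.α O.isLocalHomeomorph_α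

theorem expectationPre_left (b : C₀(O.Y, ℂ)) (c : C_c(O.Y, ℂ)) :
    O.expectationPre.left b c = b • c := rfl

theorem expectationPre_ip (b c : C_c(O.Y, ℂ)) :
    O.expectationPre.ip b c = (O.expectation (star b * c) : C₀(G.V, ℂ)) := rfl

/-- The correspondence `B^Λ`, where `B = C₀(Y)`. -/
noncomputable def expectationModule :
    Correspondence O.Y G.V (Completion O.expectationPre.Carrier) :=
  O.expectationPre.completion

/-- The fibres of `α` have uniformly bounded cardinality. -/
def HasBoundedFibres : Prop := ∃ N : ℕ, ∀ v, (O.α ⁻¹' {v}).ncard ≤ N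

end OutSplit

/-!
The sum over a fibre of `s = α ∘ ψ` is the sum over a fibre of `α` of the sums over fibres of `ψ`,
so `Λ (x ∣ y)_B = (x ∣ y)_A` on `C_c(E)`. A nonnegative function is dominated by its fibre sums, so
`‖(x ∣ x)_B‖ ≤ ‖(x ∣ x)_A‖` and the identity of `C_c(E)` extends to a contraction from `X(E)` to the
completion of `C_c(E)` in `(· ∣ ·)_B`. It is injective because the `B`-valued inner product
determines the `A`-valued one by summation over the finite fibres of `α`; hence `(· ∣ ·)_B` is
definite on `X(E)`. If these fibres have at most `N` elements, the two norms differ by a factor of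
at most `√N`.

Both `B^Λ` and `X(E)` with `(· ∣ ·)_B` are completions of `C_c(M)` for a pair of maps `W ← M → Y`,
the second a local homeomorphism: `Y ← Y → V` (identity and `α`) and `V ← E → Y` (`r` and `ψ`). The
tensor product of two such completions belongs to the fibre product, through
`b ⊗ x ↦ ((w, e) ↦ b w * x e)`. This map is isometric, and a partition of unity subordinate to open
sets on which the second map of the first pair is injective shows that it is onto. For the two pairs
above the fibre product is the edge space of the out-split graph.
-/

section FiniteFibres

variable {M Y Z : Type*}

theorem finite_fibre_of_isProperMap [TopologicalSpace M] [TopologicalSpace Y] [T2Space Y]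
    {f : M → Y} (hp : IsProperMap f) (hf : IsLocalHomeomorph f) (y : Y) : (f ⁻¹' {y}).Finite := by
  simpa using finite_compact_inter_fibre hf
    (hp.isCompact_preimage (isCompact_singleton (x := y))) y

theorem finsum_mem_fibre_comp {A : Type*} [AddCommMonoid A] (f : M → Y) (g : Y → Z) {z : Z}
    {F : M → A} (hF : ((g ∘ f) ⁻¹' {z} ∩ Function.support F).Finite) :
    ∑ᶠ y ∈ g ⁻¹' {z}, ∑ᶠ x ∈ f ⁻¹' {y}, F x = ∑ᶠ x ∈ (g ∘ f) ⁻¹' {z}, F x := by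
  classical
  have hmem : ∀ x ∈ hF.toFinset, f x ∈ hF.toFinset.image f := fun _ => Finset.mem_image_of_mem f
  have hinner : ∀ y ∈ g ⁻¹' {z},
      ∑ᶠ x ∈ f ⁻¹' {y}, F x = ∑ x ∈ hF.toFinset with f x = y, F x := fun y hy => by
    refine finsum_mem_eq_sum_of_inter_support_eq F ?_
    ext x
    simp only [Set.mem_preimage, Set.mem_singleton_iff] at hy
    simp +contextual [hy]
  rw [finsum_mem_congr rfl hinner, ← finsum_mem_inter_support F,
    finsum_mem_eq_finite_toFinset_sum F hF, ← Finset.sum_fiberwise_of_maps_to hmem]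
  refine finsum_mem_eq_sum_of_inter_support_eq _ ?_
  ext y
  simp only [Set.mem_inter_iff, Finset.coe_image, and_congr_left_iff, Function.mem_support]
  intro hy
  obtain ⟨x, hx, -⟩ := Finset.exists_ne_zero_of_sum_ne_zero hy
  obtain ⟨hxF, rfl⟩ := Finset.mem_filter.1 hx
  exact ⟨fun _ => ⟨x, hxF, rfl⟩, fun _ => (hF.mem_toFinset.1 hxF).1⟩

theorem norm_finsum_mem_le {A : Type*} [SeminormedAddCommGroup A] {S : Set Y} {N : ℕ}
    (hS : S.encard ≤ N) {f : Y → A} {C : ℝ} (hC : 0 ≤ C) (hf : ∀ y ∈ S, ‖f y‖ ≤ C) :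
    ‖∑ᶠ y ∈ S, f y‖ ≤ N * C := by
  have hfin : S.Finite := Set.finite_of_encard_le_coe hS
  have hcard : S.ncard ≤ N := by exact_mod_cast hfin.cast_ncard_eq ▸ hS
  rw [finsum_mem_eq_finite_toFinset_sum f hfin]
  refine (norm_sum_le_of_le _ fun y hy => hf y (hfin.mem_toFinset.1 hy)).trans ?_
  rw [Finset.sum_const, nsmul_eq_mul, ← Set.ncard_eq_toFinset_card S hfin]
  gcongr

theorem continuous_finsum_mem {A : Type*} [TopologicalSpace M] [AddCommMonoid A]
    [TopologicalSpace A] [ContinuousAdd A] {S : Set Y} (hS : S.Finite) {f : M → Y → A}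
    (hf : ∀ y ∈ S, Continuous fun x => f x y) : Continuous fun x => ∑ᶠ y ∈ S, f x y := by
  simp_rw [fun x => finsum_mem_eq_finite_toFinset_sum (f x) hS]
  exact continuous_finsetSum _ fun y hy => hf y (hS.mem_toFinset.1 hy)

end FiniteFibres

namespace PreCorrespondence

variable {W Y V V' : Type*} [TopologicalSpace W] [TopologicalSpace Y]
  [AddCommGroup V] [Module ℂ V] [AddCommGroup V'] [Module ℂ V']

section Completion

variable (P : PreCorrespondence W Y V)

theorem continuous_completion_left (a : C₀(W, ℂ)) : Continuous (P.completion.left a) :=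
  P.continuous_leftC a

theorem continuous_completion_right (b : C₀(Y, ℂ)) : Continuous (P.completion.right b) :=
  P.continuous_rightC b

theorem continuous_completion_ip {T : Type*} [TopologicalSpace T]
    {f g : T → Completion P.Carrier} (hf : Continuous f) (hg : Continuous g) :
    Continuous fun t => P.completion.ip (f t) (g t) :=
  P.continuous_ipC hf hg

theorem denseRange_ι_comp {D : Type*} {f : D → V} (hf : DenseRange (P.toCarrier ∘ f)) :
    DenseRange (P.ι ∘ f) :=
  (Completion.denseRange_coe (α := P.Carrier)).comp hf (Completion.continuous_coe P.Carrier)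

end Completion

/-- A linear map of pre-correspondences over the same algebras that preserves the inner products
and intertwines the left and the right actions. -/
structure IsIsometricHom (P : PreCorrespondence W Y V) (Q : PreCorrespondence W Y V')
    (f : V →ₗ[ℂ] V') : Prop where
  ip_map : ∀ x y, Q.ip (f x) (f y) = P.ip x y
  map_left : ∀ a x, f (P.left a x) = Q.left a (f x)
  map_right : ∀ b x, f (P.right b x) = Q.right b (f x)

theorem IsIsometricHom.norm_ι {P : PreCorrespondence W Y V} {Q : PreCorrespondence W Y V'}
    {f : V →ₗ[ℂ] V'} (hf : P.IsIsometricHom Q f) (x : V) : ‖Q.ι (f x)‖ = ‖P.ι x‖ := by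
  rw [← sq_eq_sq₀ (norm_nonneg _) (norm_nonneg _), norm_sq_ι, norm_sq_ι, hf.ip_map]

theorem IsIsometricHom.completion_isIsomorphic {P : PreCorrespondence W Y V}
    {Q : PreCorrespondence W Y V'} {f : V →ₗ[ℂ] V'} (hf : P.IsIsometricHom Q f)
    (hd : DenseRange (Q.toCarrier ∘ f)) : P.completion.IsIsomorphic Q.completion := by
  have hnorm : ∀ x, ‖(Q.ι ∘ₗ f) (LinearEquiv.refl ℂ V x)‖ = ‖P.ι x‖ := hf.norm_ι
  have hd' : DenseRange (Q.ι ∘ₗ f) := Q.denseRange_ι_comp hd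
  let β := (LinearEquiv.refl ℂ V).extendOfIsometry P.ι (Q.ι ∘ₗ f) P.denseRange_ι hd' hnorm
  have hβ : ∀ x, β (P.ι x) = Q.ι (f x) :=
    LinearEquiv.extendOfIsometry_eq _ _ _ P.denseRange_ι hd' hnorm
  have hβc : Continuous β := β.continuous
  refine ⟨β.toLinearEquiv, fun x y => ?_, fun x b => ?_, fun a x => ?_⟩
  · change Q.completion.ip (β x) (β y) = P.completion.ip x y
    induction x, y using P.induction_ι₂ with
    | hp =>
      exact isClosed_eq
        (Q.continuous_completion_ip (hβc.comp continuous_fst) (hβc.comp continuous_snd))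
        (P.continuous_completion_ip continuous_fst continuous_snd)
    | h x y => rw [hβ, hβ, completion_ip_ι, completion_ip_ι, hf.ip_map]
  · change β (P.completion.right b x) = Q.completion.right b (β x)
    induction x using P.induction_ι with
    | hp =>
      exact isClosed_eq (hβc.comp (P.continuous_completion_right b))
        ((Q.continuous_completion_right b).comp hβc)
    | h x => rw [completion_right_ι, hβ, hβ, completion_right_ι, hf.map_right]
  · change β (P.completion.left a x) = Q.completion.left a (β x)
    induction x using P.induction_ι with
    | hp =>
      exact isClosed_eq (hβc.comp (P.continuous_completion_left a))
        ((Q.continuous_completion_left a).comp hβc)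
    | h x => rw [completion_left_ι, hβ, hβ, completion_left_ι, hf.map_left]

theorem isIsometricHom_ι (P : PreCorrespondence W Y V) :
    P.IsIsometricHom P.completion.toPreCorrespondence P.ι where
  ip_map := P.completion_ip_ι
  map_left a x := (P.completion_left_ι a x).symm
  map_right b x := (P.completion_right_ι b x).symm

/-- The pre-correspondence pulled back along an injective linear map `f`; the intertwined actions
`l` and `r` are determined by `f`. -/
noncomputable def comap (Q : PreCorrespondence W Y V') (f : V →ₗ[ℂ] V') (hf : Function.Injective f)
    (l : C₀(W, ℂ) →ₗ[ℂ] V →ₗ[ℂ] V) (r : C₀(Y, ℂ) →ₗ[ℂ] V →ₗ[ℂ] V)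
    (hl : ∀ a x, f (l a x) = Q.left a (f x)) (hr : ∀ b x, f (r b x) = Q.right b (f x)) :
    PreCorrespondence W Y V where
  left := l
  right := r
  ip := (Q.ip.comp f).compl₂ f
  ip_star x y := Q.ip_star (f x) (f y)
  ip_nonneg x := Q.ip_nonneg (f x)
  ip_right x y b := by
    simp only [LinearMap.compl₂_apply, LinearMap.comp_apply, hr, Q.ip_right]
  right_mul b c x := hf (by rw [hr, hr, hr, Q.right_mul])
  left_mul a c x := hf (by rw [hl, hl, hl, Q.left_mul])
  ip_left a x y := by
    simp only [LinearMap.compl₂_apply, LinearMap.comp_apply, hl, Q.ip_left]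
  left_right a b x := hf (by rw [hl, hr, hr, hl, Q.left_right])

end PreCorrespondence

theorem Correspondence.IsIsomorphic.symm {W Y X X' : Type*} [TopologicalSpace W]
    [TopologicalSpace Y] [NormedAddCommGroup X] [NormedSpace ℂ X] [NormedAddCommGroup X']
    [NormedSpace ℂ X'] {P : Correspondence W Y X} {Q : Correspondence W Y X'}
    (h : P.IsIsomorphic Q) : Q.IsIsomorphic P := by
  obtain ⟨β, hip, hright, hleft⟩ := h
  refine ⟨β.symm, fun x y => ?_, fun x b => β.injective ?_, fun a x => β.injective ?_⟩
  · rw [← hip, β.apply_symm_apply, β.apply_symm_apply]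
  · rw [hright, β.apply_symm_apply, β.apply_symm_apply]
  · rw [hleft, β.apply_symm_apply, β.apply_symm_apply]

theorem Correspondence.IsIsomorphic.trans {W Y X X' X'' : Type*} [TopologicalSpace W]
    [TopologicalSpace Y] [NormedAddCommGroup X] [NormedSpace ℂ X] [NormedAddCommGroup X']
    [NormedSpace ℂ X'] [NormedAddCommGroup X''] [NormedSpace ℂ X''] {P : Correspondence W Y X}
    {Q : Correspondence W Y X'} {R : Correspondence W Y X''} (h : P.IsIsomorphic Q)
    (h' : Q.IsIsomorphic R) : P.IsIsomorphic R := by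
  obtain ⟨β, hip, hright, hleft⟩ := h
  obtain ⟨γ, hip', hright', hleft'⟩ := h'
  refine ⟨β.trans γ, fun x y => ?_, fun x b => ?_, fun a x => ?_⟩
  · exact (hip' _ _).trans (hip x y)
  · exact (congrArg γ (hright x b)).trans (hright' _ b)
  · exact (congrArg γ (hleft a x)).trans (hleft' a _)

namespace PreCorrespondence

variable {W Z Y V₁ V₁' V₂ V₂' : Type*} [TopologicalSpace W] [TopologicalSpace Z]
  [TopologicalSpace Y] [AddCommGroup V₁] [Module ℂ V₁] [AddCommGroup V₁'] [Module ℂ V₁']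
  [AddCommGroup V₂] [Module ℂ V₂] [AddCommGroup V₂'] [Module ℂ V₂']

theorem IsIsometricHom.algTensor {Q : PreCorrespondence W Z V₁} {Q' : PreCorrespondence W Z V₁'}
    {P : PreCorrespondence Z Y V₂} {P' : PreCorrespondence Z Y V₂'} {f : V₁ →ₗ[ℂ] V₁'}
    {g : V₂ →ₗ[ℂ] V₂'} (hf : Q.IsIsometricHom Q' f) (hg : P.IsIsometricHom P' g) :
    (Q.algTensor P).IsIsometricHom (Q'.algTensor P') (TensorProduct.map f g) where
  ip_map ξ η := by
    induction ξ with
    | zero => simp only [map_zero, LinearMap.zero_apply]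
    | add ξ ξ' h h' => simp only [map_add, LinearMap.add_apply, h, h']
    | tmul x y =>
      induction η with
      | zero => simp only [map_zero]
      | add η η' h h' => simp only [map_add, h, h']
      | tmul x' y' =>
        change P'.ip (g y) (P'.left (Q'.ip (f x) (f x')) (g y')) = P.ip y (P.left (Q.ip x x') y')
        rw [hf.ip_map, ← hg.map_left, hg.ip_map]
  map_left a ξ := by
    induction ξ with
    | zero => simp only [map_zero]
    | add ξ ξ' h h' => simp only [map_add, h, h']
    | tmul x y => exact congrArg (· ⊗ₜ[ℂ] g y) (hf.map_left a x)
  map_right b ξ := by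
    induction ξ with
    | zero => simp only [map_zero]
    | add ξ ξ' h h' => simp only [map_add, h, h']
    | tmul x y => exact congrArg (f x ⊗ₜ[ℂ] ·) (hg.map_right b y)

variable (Q : PreCorrespondence W Z V₁) (P : PreCorrespondence Z Y V₂)

theorem norm_toCarrier_tmul_le (x : V₁) (y : V₂) :
    ‖(Q.algTensor P).toCarrier (x ⊗ₜ y)‖ ≤ ‖Q.toCarrier x‖ * ‖P.toCarrier y‖ := by
  refine le_of_sq_le_sq ?_ (by positivity)
  calc ‖(Q.algTensor P).toCarrier (x ⊗ₜ y)‖ ^ 2 = ‖P.ip y (P.left (Q.ip x x) y)‖ :=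
        (Q.algTensor P).norm_sq_toCarrier (x ⊗ₜ y)
    _ ≤ ‖P.toCarrier y‖ * ‖P.toCarrier (P.left (Q.ip x x) y)‖ := by
        rw [norm_toCarrier, norm_toCarrier]
        exact P.norm_ip_le _ _
    _ ≤ ‖P.toCarrier y‖ * (‖Q.toCarrier x‖ ^ 2 * ‖P.toCarrier y‖) := by
        rw [norm_sq_toCarrier]
        gcongr
        exact P.norm_left_le _ _
    _ = (‖Q.toCarrier x‖ * ‖P.toCarrier y‖) ^ 2 := by ring

/-- The map `(x, y) ↦ x ⊗ y` as a bounded bilinear map of seminormed spaces. -/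
noncomputable def tmulL : Q.Carrier →L[ℂ] P.Carrier →L[ℂ] (Q.algTensor P).Carrier :=
  LinearMap.mkContinuous₂ (TensorProduct.mk ℂ V₁ V₂) 1 fun x y => by
    rw [one_mul]
    exact Q.norm_toCarrier_tmul_le P x y

theorem denseRange_toCarrier_map {D₁ D₂ : Type*} [AddCommGroup D₁] [Module ℂ D₁]
    [AddCommGroup D₂] [Module ℂ D₂] {f : D₁ →ₗ[ℂ] V₁} {g : D₂ →ₗ[ℂ] V₂}
    (hf : DenseRange (Q.toCarrier ∘ f)) (hg : DenseRange (P.toCarrier ∘ g)) :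
    DenseRange ((Q.algTensor P).toCarrier ∘ TensorProduct.map f g) := by
  let S : Submodule ℂ (Q.algTensor P).Carrier :=
    (LinearMap.range (TensorProduct.map f g)).map (Q.algTensor P).toCarrier.toLinearMap
  have htmul : ∀ p : Q.Carrier × P.Carrier, Q.tmulL P p.1 p.2 ∈ S.topologicalClosure := fun p =>
    (hf.prodMap hg).induction_on p
      (S.isClosed_topologicalClosure.preimage
        (((Q.tmulL P).continuous.comp continuous_fst).clm_apply continuous_snd))
      fun d => S.le_topologicalClosure ⟨_, ⟨d.1 ⊗ₜ d.2, rfl⟩, rfl⟩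
  have hmem : ∀ ξ, (Q.algTensor P).toCarrier ξ ∈ S.topologicalClosure := fun ξ => by
    induction ξ with
    | zero => exact map_zero (Q.algTensor P).toCarrier ▸ S.topologicalClosure.zero_mem
    | add ξ ξ' h h' => exact map_add (Q.algTensor P).toCarrier ξ ξ' ▸ add_mem h h'
    | tmul x y => exact htmul (Q.toCarrier x, P.toCarrier y)
  have hS : (S : Set (Q.algTensor P).Carrier)
      = Set.range ((Q.algTensor P).toCarrier ∘ TensorProduct.map f g) :=
    (Set.range_comp _ _).symm
  intro ξ
  rw [← hS]
  exact hmem ((Q.algTensor P).toCarrier.symm ξ)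

end PreCorrespondence

section FibreSums

variable {M Y Z : Type*}

theorem le_finsum_mem_of_nonneg {A : Type*} [AddCommMonoid A] [PartialOrder A]
    [IsOrderedAddMonoid A] {S : Set M} {F : M → A} (hF : (S ∩ Function.support F).Finite)
    (hF₀ : ∀ x ∈ S, 0 ≤ F x) {x : M} (hx : x ∈ S) : F x ≤ ∑ᶠ x ∈ S, F x := by
  rw [finsum_mem_def, ← Set.indicator_of_mem hx F]
  refine single_le_finsum x ?_ fun y => Set.indicator_nonneg hF₀ y
  rwa [Function.HasFiniteSupport, Set.support_indicator]

theorem eq_zero_of_finsum_mem_fibre_star_mul_self {s : M → Y} {F : M → ℂ}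
    (hF : ∀ y, (s ⁻¹' {y} ∩ Function.support F).Finite)
    (h : ∀ y, ∑ᶠ x ∈ s ⁻¹' {y}, star (F x) * F x = 0) : F = 0 := by
  funext x
  have hfin : (s ⁻¹' {s x} ∩ Function.support fun x => star (F x) * F x).Finite :=
    (hF (s x)).subset (Set.inter_subset_inter_right _ fun _ => right_ne_zero_of_mul)
  have hle : star (F x) * F x ≤ 0 := (h (s x)).subst
    (le_finsum_mem_of_nonneg hfin (fun x _ => star_mul_self_nonneg (F x)) rfl)
  exact (CStarRing.star_mul_self_eq_zero_iff (F x)).1 (hle.antisymm (star_mul_self_nonneg (F x)))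

variable [TopologicalSpace M] [TopologicalSpace Y] [TopologicalSpace Z]

theorem finite_fibre_inter_support [T2Space Y] {s : M → Y} (hs : IsLocalHomeomorph s)
    (x : C_c(M, ℂ)) (y : Y) : (s ⁻¹' {y} ∩ Function.support x).Finite :=
  (finite_compact_inter_fibre hs x.hasCompactSupport.isCompact y).subset
    fun _ h => ⟨subset_tsupport x h.2, h.1⟩

variable [T2Space M] [LocallyCompactSpace M] [T2Space Y]

theorem apply_le_fibreSum_apply {s : M → Y} (hs : IsLocalHomeomorph s) {x : C_c(M, ℂ)}
    (hx : ∀ e, 0 ≤ x e) (e : M) : x e ≤ fibreSum s hs x (s e) :=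
  le_finsum_mem_of_nonneg (finite_fibre_inter_support hs x (s e)) (fun e _ => hx e) rfl

theorem eq_zero_of_fibreSum_star_mul_self {s : M → Y} (hs : IsLocalHomeomorph s) {x : C_c(M, ℂ)}
    (h : fibreSum s hs (star x * x) = 0) : x = 0 :=
  DFunLike.coe_injective <| eq_zero_of_finsum_mem_fibre_star_mul_self
    (finite_fibre_inter_support hs x) fun y => DFunLike.congr_fun h y

theorem fibreSum_pullbackMul {s : M → Y} (hs : IsLocalHomeomorph s) (a : C₀(Y, ℂ))
    (x : C_c(M, ℂ)) :
    fibreSum s hs (pullbackMul ⟨s, hs.continuous⟩ a x) = a • fibreSum s hs x := by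
  ext y
  change ∑ᶠ e ∈ s ⁻¹' {y}, a (s e) * x e = a y * ∑ᶠ e ∈ s ⁻¹' {y}, x e
  rw [mul_finsum_mem]
  exact finsum_mem_congr rfl fun e he => congrArg (a · * x e) he

section Composition

variable [LocallyCompactSpace Y] [T2Space Z] {f : M → Y} {g : Y → Z} {s : M → Z}
  (hf : IsLocalHomeomorph f) (hg : IsLocalHomeomorph g) (hs : IsLocalHomeomorph s) (h : g ∘ f = s)

include hg h

theorem fibreSum_fibreSum (x : C_c(M, ℂ)) :
    fibreSum g hg (fibreSum f hf x) = fibreSum s hs x := by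
  subst h
  ext z
  exact finsum_mem_fibre_comp f g (finite_fibre_inter_support hs x z)

theorem norm_fibreIp_self_le (x : C_c(M, ℂ)) : ‖fibreIp f hf x x‖ ≤ ‖fibreIp s hs x x‖ := by
  refine PreCorrespondence.norm_le_of_forall _ (norm_nonneg _) fun u => ?_
  have hnonneg : ∀ u, 0 ≤ fibreSum f hf (star x * x) u :=
    fibreSum_nonneg f hf _ fun e => star_mul_self_nonneg (x e)
  calc ‖fibreIp f hf x x u‖ ≤ ‖fibreSum g hg (fibreSum f hf (star x * x)) (g u)‖ :=
        CStarAlgebra.norm_le_norm_of_nonneg_of_le (hnonneg u) (apply_le_fibreSum_apply hg hnonneg u)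
    _ = ‖fibreIp s hs x x (g u)‖ := by rw [fibreSum_fibreSum hf hg hs h]; rfl
    _ ≤ ‖fibreIp s hs x x‖ := PreCorrespondence.norm_apply_le _ _

end Composition

end FibreSums

section Pullback

variable {M N Z : Type*} {s : M → Z} {r : N → Z}

theorem bijOn_pullback_fst (e : N) :
    Set.BijOn (fun p : s.Pullback r => p.1.1) ((fun p : s.Pullback r => p.1.2) ⁻¹' {e})
      (s ⁻¹' {r e}) :=
  ⟨fun p hp => p.2.trans (congrArg r hp),
    fun _ hp _ hq h => Subtype.ext (Prod.ext h (Eq.trans hp (Eq.symm hq))),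
    fun w hw => ⟨⟨(w, e), hw⟩, rfl, rfl⟩⟩

theorem pullback_ext_of_injOn {U : Set M} (hU : U.InjOn s) {p q : s.Pullback r} (hp : p.1.1 ∈ U)
    (hq : q.1.1 ∈ U) (h : p.1.2 = q.1.2) : p = q :=
  Subtype.ext (Prod.ext (hU hp hq (p.2.trans ((congrArg r h).trans q.2.symm))) h)

theorem finsum_mem_pullback_snd_fibre_of_injOn {A : Type*} [AddCommMonoid A] {U : Set M}
    (hU : U.InjOn s) {g : s.Pullback r → A} (hg : ∀ p, p.1.1 ∉ U → g p = 0) {p : s.Pullback r}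
    (hp : p.1.1 ∈ U) : ∑ᶠ q ∈ (fun q : s.Pullback r => q.1.2) ⁻¹' {p.1.2}, g q = g p := by
  rw [finsum_mem_def, finsum_eq_single _ p fun q hq => ?_]
  · exact Set.indicator_of_mem (s := (fun q : s.Pullback r => q.1.2) ⁻¹' {p.1.2}) rfl g
  · exact Set.indicator_apply_eq_zero.2 fun hqp =>
      hg q fun hqU => hq (pullback_ext_of_injOn hU hqU hp hqp)

end Pullback

section TensorToPullback

variable {X M N Z : Type*} [TopologicalSpace X] [TopologicalSpace M] [TopologicalSpace N]
  [TopologicalSpace Z]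

theorem mem_addSubmonoid_of_supported_over_cover [T2Space M] [LocallyCompactSpace M] {ι : Type*}
    {U : ι → Set M} (hU : ∀ i, IsOpen (U i)) (hcover : ⋃ i, U i = Set.univ) {f : X → M}
    (hf : Continuous f) {S : AddSubmonoid C_c(X, ℂ)}
    (hS : ∀ i K, IsCompact K → K ⊆ U i → ∀ g : C_c(X, ℂ), (∀ x, f x ∉ K → g x = 0) → g ∈ S)
    (g : C_c(X, ℂ)) : g ∈ S := by
  have hK : IsCompact (f '' tsupport g) := g.hasCompactSupport.isCompact.image hf
  obtain ⟨t, ht⟩ := hK.elim_finite_subcover U hU (hcover ▸ Set.subset_univ _)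
  have ht' : f '' tsupport g ⊆ ⋃ k, U (t.equivFin.symm k) := ht.trans <|
    Set.iUnion₂_subset fun i hi => Set.subset_iUnion_of_subset (t.equivFin ⟨i, hi⟩) (by simp)
  obtain ⟨ρ, hρU, hρ1, -, hρc⟩ := exists_continuous_sum_one_of_isOpen_isCompact
    (fun k => hU (t.equivFin.symm k)) hK ht'
  let piece (k : Fin t.card) : C_c(X, ℂ) := (⟨fun x => (ρ k (f x) : ℂ), by fun_prop⟩ : C(X, ℂ)) • g
  have hsum : ∑ k, piece k = g := by
    ext x
    rw [CompactlySupportedContinuousMap.sum_apply]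
    change ∑ k, (ρ k (f x) : ℂ) * g x = g x
    rw [← Finset.sum_mul, ← Complex.ofReal_sum]
    by_cases hx : x ∈ tsupport g
    · have h1 : ∑ k, ρ k (f x) = 1 := by simpa using hρ1 ⟨x, hx, rfl⟩
      rw [h1, Complex.ofReal_one, one_mul]
    · rw [image_eq_zero_of_notMem_tsupport hx, mul_zero]
  rw [← hsum]
  refine S.sum_mem fun k _ => hS _ _ (hρc k) (hρU k) _ fun x hx => ?_
  change (ρ k (f x) : ℂ) * g x = 0
  rw [image_eq_zero_of_notMem_tsupport hx, Complex.ofReal_zero, zero_mul]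

section

variable [T2Space M] [T2Space N] [T2Space Z] {s : M → Z} {r : N → Z} (hs : Continuous s)
  (hr : Continuous r)

include hs hr in
theorem hasCompactSupport_pullback_mul (b : C_c(M, ℂ)) (x : C_c(N, ℂ)) :
    HasCompactSupport fun p : s.Pullback r => b p.1.1 * x p.1.2 := by
  have hemb : Topology.IsClosedEmbedding (Subtype.val : s.Pullback r → M × N) :=
    (isClosed_eq (hs.comp continuous_fst) (hr.comp continuous_snd)).isClosedEmbedding_subtypeVal
  refine HasCompactSupport.of_support_subset_isCompact (hemb.isCompact_preimage
    (b.hasCompactSupport.isCompact.prod x.hasCompactSupport.isCompact)) fun p hp => ?_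
  exact ⟨subset_tsupport b (left_ne_zero_of_mul hp), subset_tsupport x (right_ne_zero_of_mul hp)⟩

/-- The linear map that sends `b ⊗ x` to the function `(w, e) ↦ b w * x e` on the fibre product of
`s` and `r`. -/
noncomputable def tensorToPullback :
    C_c(M, ℂ) ⊗[ℂ] C_c(N, ℂ) →ₗ[ℂ] C_c(Function.Pullback s r, ℂ) :=
  TensorProduct.lift (LinearMap.mk₂ ℂ
    (fun b x => ⟨⟨fun p => b p.1.1 * x p.1.2, by fun_prop⟩,
      hasCompactSupport_pullback_mul hs hr b x⟩)
    (fun _ _ _ => by ext; exact add_mul _ _ _) (fun _ _ _ => by ext; exact mul_assoc _ _ _)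
    (fun _ _ _ => by ext; exact mul_add _ _ _) (fun _ _ _ => by ext; exact mul_left_comm _ _ _))

theorem star_tensorToPullback_mul (b b' : C_c(M, ℂ)) (x x' : C_c(N, ℂ)) :
    star (tensorToPullback hs hr (b ⊗ₜ x)) * tensorToPullback hs hr (b' ⊗ₜ x')
      = tensorToPullback hs hr ((star b * b') ⊗ₜ (star x * x')) := by
  ext p
  change conj (b p.1.1 * x p.1.2) * (b' p.1.1 * x' p.1.2)
    = conj (b p.1.1) * b' p.1.1 * (conj (x p.1.2) * x' p.1.2)
  rw [map_mul, mul_mul_mul_comm]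

end

section BaseChange

variable [T2Space M] [LocallyCompactSpace M] [T2Space N] [T2Space Z] {s : M → Z} {r : N → Z}
  (hs : IsLocalHomeomorph s) (hr : Continuous r) [LocallyCompactSpace (s.Pullback r)]
  (hsnd : IsLocalHomeomorph fun p : s.Pullback r => p.1.2)

theorem fibreSum_tensorToPullback (b : C_c(M, ℂ)) (x : C_c(N, ℂ)) :
    fibreSum _ hsnd (tensorToPullback hs.continuous hr (b ⊗ₜ x))
      = pullbackMul ⟨r, hr⟩ (fibreSum s hs b) x := by
  ext e
  change ∑ᶠ p ∈ (fun p : s.Pullback r => p.1.2) ⁻¹' {e}, b p.1.1 * x p.1.2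
    = (∑ᶠ w ∈ s ⁻¹' {r e}, b w) * x e
  rw [finsum_mem_mul]
  exact finsum_mem_eq_of_bijOn _ (bijOn_pullback_fst e) fun p hp => congrArg (b p.1.1 * x ·) hp

theorem isIsometricHom_tensorToPullback [LocallyCompactSpace N] {W Y : Type*}
    [TopologicalSpace W] [TopologicalSpace Y] [T2Space Y] {q : M → W} (hq : Continuous q)
    {t : N → Y} (ht : IsLocalHomeomorph t) :
    ((fibrePreCorrespondence q hq s hs).algTensor
        (fibrePreCorrespondence r hr t ht)).IsIsometricHom
      (fibrePreCorrespondence (fun p : s.Pullback r => q p.1.1) (hq.comp (by fun_prop))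
        (fun p : s.Pullback r => t p.1.2) (ht.comp hsnd))
      (tensorToPullback hs.continuous hr) where
  ip_map ξ η := by
    induction ξ with
    | zero => simp only [map_zero, LinearMap.zero_apply]
    | add ξ ξ' h h' => simp only [map_add, LinearMap.add_apply, h, h']
    | tmul b x =>
      induction η with
      | zero => simp only [map_zero]
      | add η η' h h' => simp only [map_add, h, h']
      | tmul b' x' =>
        change (fibreSum _ (ht.comp hsnd) (star (tensorToPullback hs.continuous hr (b ⊗ₜ x))
            * tensorToPullback hs.continuous hr (b' ⊗ₜ x')) : C₀(Y, ℂ))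
          = (fibreSum t ht (star x * pullbackMul ⟨r, hr⟩ (fibreSum s hs (star b * b')) x') :
            C₀(Y, ℂ))
        rw [star_tensorToPullback_mul, ← fibreSum_fibreSum hsnd ht (ht.comp hsnd) rfl,
          fibreSum_tensorToPullback hs]
        refine congrArg (fun y : C_c(N, ℂ) => (fibreSum t ht y : C₀(Y, ℂ))) ?_
        ext e
        exact mul_left_comm (fibreSum s hs (star b * b') (r e)) (conj (x e)) (x' e)
  map_left a ξ := by
    induction ξ with
    | zero => simp only [map_zero]
    | add ξ ξ' h h' => simp only [map_add, h, h']
    | tmul b x => ext p; exact mul_assoc _ _ _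
  map_right a ξ := by
    induction ξ with
    | zero => simp only [map_zero]
    | add ξ ξ' h h' => simp only [map_add, h, h']
    | tmul b x => ext p; exact mul_left_comm _ _ _

include hsnd in
/-- On a sheet of `s` the fibre of `snd` through `p` meets the support of `g` only in `p`, so that
`g` is the product of a bump function and its own fibre sum. -/
theorem mem_range_tensorToPullback_of_injOn {U K : Set M} (hU : IsOpen U) (hUs : U.InjOn s)
    (hK : IsCompact K) (hKU : K ⊆ U) {g : C_c(s.Pullback r, ℂ)}
    (hg : ∀ p : s.Pullback r, p.1.1 ∉ K → g p = 0) :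
    g ∈ LinearMap.range (tensorToPullback hs.continuous hr) := by
  obtain ⟨f, hf1, hf0, hfc, -⟩ := exists_continuous_one_zero_of_isCompact hK hU.isClosed_compl
    (Set.disjoint_compl_right_iff_subset.2 hKU)
  let b : C_c(M, ℂ) := ⟨⟨fun u => (f u : ℂ), by fun_prop⟩,
    hfc.comp_left (g := fun t : ℝ => (t : ℂ)) Complex.ofReal_zero⟩
  refine ⟨b ⊗ₜ fibreSum _ hsnd g, ?_⟩
  ext p
  change (f p.1.1 : ℂ) * fibreSum _ hsnd g p.1.2 = g p
  by_cases hpU : p.1.1 ∈ U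
  · rw [fibreSum_apply,
      finsum_mem_pullback_snd_fibre_of_injOn hUs (fun q hq => hg q fun h => hq (hKU h)) hpU]
    by_cases hpK : p.1.1 ∈ K
    · rw [hf1 hpK, Pi.one_apply, Complex.ofReal_one, one_mul]
    · rw [hg p hpK, mul_zero]
  · rw [hf0 hpU, Pi.zero_apply, Complex.ofReal_zero, zero_mul, hg p fun h => hpU (hKU h)]

include hsnd in
theorem tensorToPullback_surjective :
    Function.Surjective (tensorToPullback hs.continuous hr) := by
  choose c hc hsc using id hs
  have hcover : ⋃ z, (c z).source = Set.univ :=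
    Set.iUnion_eq_univ_iff.2 fun z => ⟨z, hc z⟩
  refine fun g => mem_addSubmonoid_of_supported_over_cover (fun z => (c z).open_source) hcover
    (f := fun p : s.Pullback r => p.1.1) (by fun_prop)
    (S := (LinearMap.range (tensorToPullback hs.continuous hr)).toAddSubmonoid)
    (fun z K hK hKU g hg => ?_) g
  exact mem_range_tensorToPullback_of_injOn hs hr hsnd (c z).open_source (hsc z ▸ (c z).injOn) hK
    hKU hg

end BaseChange

end TensorToPullback

section ZeroAtInfty

variable {M Y : Type*} [TopologicalSpace M] [TopologicalSpace Y]

variable (Y) in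
/-- The inclusion of `C_c(Y)` into `C₀(Y)` as a linear map. -/
noncomputable def compactlySupportedInclusion : C_c(Y, ℂ) →ₗ[ℂ] C₀(Y, ℂ) where
  toFun b := b
  map_add' _ _ := rfl
  map_smul' _ _ := rfl

theorem denseRange_compactlySupportedInclusion [T2Space Y] [LocallyCompactSpace Y] :
    DenseRange (compactlySupportedInclusion Y) := by
  refine Metric.denseRange_iff.2 fun b ε hε => ?_
  have hev : ∀ᶠ u in Filter.cocompact Y, ‖b u‖ < ε / 2 := by
    have h : Filter.Tendsto (fun u => ‖b u‖) (Filter.cocompact Y) (nhds 0) := by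
      simpa using b.zero_at_infty'.norm
    exact h.eventually (gt_mem_nhds (by positivity))
  obtain ⟨K, hK, hKb⟩ := Filter.mem_cocompact.1 hev
  obtain ⟨f, hf1, -, hfc, hf01⟩ := exists_continuous_one_zero_of_isCompact hK isClosed_empty
    (Set.disjoint_empty K)
  refine ⟨⟨⟨fun u => (f u : ℂ) * b u, by fun_prop⟩,
    (hfc.comp_left (g := fun t : ℝ => (t : ℂ)) Complex.ofReal_zero).mul_right⟩, ?_⟩
  rw [dist_eq_norm]
  refine (PreCorrespondence.norm_le_of_forall _ (half_pos hε).le fun u => ?_).trans_lt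
    (half_lt_self hε)
  have hfactor : b u - f u * b u = ((1 - f u : ℝ) : ℂ) * b u := by push_cast; ring
  have hnorm : ‖b u - f u * b u‖ = (1 - f u) * ‖b u‖ := by
    rw [hfactor, norm_mul, Complex.norm_real, Real.norm_of_nonneg (sub_nonneg.2 (hf01 u).2)]
  refine hnorm.trans_le ?_
  by_cases hu : u ∈ K
  · rw [hf1 hu, Pi.one_apply, sub_self, zero_mul]
    positivity
  · have hbu : ‖b u‖ < ε / 2 := hKb hu
    exact (mul_le_of_le_one_left (norm_nonneg _) (sub_le_self _ (hf01 u).1)).trans hbu.le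

/-- The `*`-homomorphism `a ↦ a ∘ f` from `C₀(Y)` to `C₀(M)`, for a proper map `f : M → Y`. -/
noncomputable def zeroAtInftyPullback (f : M → Y) (hf : IsProperMap f) :
    C₀(Y, ℂ) →⋆ₙₐ[ℂ] C₀(M, ℂ) :=
  { ZeroAtInftyContinuousMap.compNonUnitalAlgHom
      (⟨⟨f, hf.continuous⟩, Filter.hasBasis_cocompact.tendsto_right_iff.2 fun _ hK =>
        (hf.isCompact_preimage hK).compl_mem_cocompact⟩ : CocompactMap M Y) with
    map_star' := fun _ => rfl }

theorem zeroAtInftyPullback_apply {f : M → Y} (hf : IsProperMap f) (a : C₀(Y, ℂ)) (x : M) :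
    zeroAtInftyPullback f hf a x = a (f x) := rfl

theorem zeroAtInftyPullback_injective {f : M → Y} (hf : IsProperMap f)
    (hsurj : Function.Surjective f) : Function.Injective (zeroAtInftyPullback f hf) := by
  intro a b h
  ext y
  obtain ⟨x, rfl⟩ := hsurj y
  exact DFunLike.congr_fun h x

end ZeroAtInfty

section BoundedFibres

variable {M Y : Type*} [TopologicalSpace M] [T2Space M] [LocallyCompactSpace M]
  [TopologicalSpace Y] [T2Space Y] (s : M → Y) (hs : IsLocalHomeomorph s)

/-- The extension of `fibreSum` to `C₀(M)`; it is given by the same formula when the fibres of `s`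
have uniformly bounded cardinality, and is a junk value otherwise. -/
noncomputable def fibreSumL : C₀(M, ℂ) →L[ℂ] C₀(Y, ℂ) :=
  (compactlySupportedInclusion Y ∘ₗ fibreSum s hs).extendOfNorm (compactlySupportedInclusion M)

/-- The extension to `C₀(M)` of the canonical map from `C_c(M)` to its completion in the inner
product along `s`; it is a junk value unless the fibres of `s` have uniformly bounded
cardinality. -/
noncomputable def toFibreCompletion :
    C₀(M, ℂ) →L[ℂ] Completion (fibrePreCorrespondence id continuous_id s hs).Carrier :=
  (fibrePreCorrespondence id continuous_id s hs).ι.extendOfNorm (compactlySupportedInclusion M)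

variable {s} {N : ℕ} (hN : ∀ y, (s ⁻¹' {y}).encard ≤ N)

include hN

theorem norm_fibreSum_le (b : C_c(M, ℂ)) :
    ‖(compactlySupportedInclusion Y ∘ₗ fibreSum s hs) b‖ ≤ N * ‖compactlySupportedInclusion M b‖ :=
  PreCorrespondence.norm_le_of_forall _ (by positivity) fun y =>
    norm_finsum_mem_le (hN y) (norm_nonneg _)
      fun e _ => PreCorrespondence.norm_apply_le (compactlySupportedInclusion M b) e

theorem norm_fibrePreCorrespondence_ι_le (b : C_c(M, ℂ)) :
    ‖(fibrePreCorrespondence id continuous_id s hs).ι b‖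
      ≤ √N * ‖compactlySupportedInclusion M b‖ := by
  refine le_of_sq_le_sq ?_ (by positivity)
  rw [mul_pow, Real.sq_sqrt (Nat.cast_nonneg N), PreCorrespondence.norm_sq_ι, sq,
    ← CStarRing.norm_star_mul_self]
  exact norm_fibreSum_le hs hN (star b * b)

theorem fibreSumL_coe (b : C_c(M, ℂ)) :
    fibreSumL s hs (compactlySupportedInclusion M b)
      = compactlySupportedInclusion Y (fibreSum s hs b) :=
  LinearMap.extendOfNorm_eq denseRange_compactlySupportedInclusion ⟨N, norm_fibreSum_le hs hN⟩ b

theorem fibreSumL_apply (b : C₀(M, ℂ)) (y : Y) : fibreSumL s hs b y = ∑ᶠ x ∈ s ⁻¹' {y}, b x := by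
  refine denseRange_compactlySupportedInclusion.induction_on b (isClosed_eq
    ((PreCorrespondence.continuous_eval y).comp (fibreSumL s hs).continuous)
    (continuous_finsum_mem (Set.finite_of_encard_le_coe (hN y))
      fun x _ => PreCorrespondence.continuous_eval x)) fun b => ?_
  rw [fibreSumL_coe hs hN]
  rfl

theorem fibreSumL_nonneg (b : C₀(M, ℂ)) (hb : ∀ x, 0 ≤ b x) (y : Y) : 0 ≤ fibreSumL s hs b y := by
  rw [fibreSumL_apply hs hN]
  exact finsum_mem_induction (fun z : ℂ => 0 ≤ z) le_rfl (fun _ _ => add_nonneg) fun x _ => hb x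

theorem eq_zero_of_fibreSumL_star_mul_self (b : C₀(M, ℂ)) (h : fibreSumL s hs (star b * b) = 0) :
    b = 0 := by
  refine DFunLike.coe_injective (eq_zero_of_finsum_mem_fibre_star_mul_self
    (fun y => (Set.finite_of_encard_le_coe (hN y)).inter_of_left _) fun y => ?_)
  exact (fibreSumL_apply hs hN (star b * b) y).symm.trans (DFunLike.congr_fun h y)

theorem fibreSumL_pullback_mul_mul_pullback (hp : IsProperMap s) (a₁ a₂ : C₀(Y, ℂ))
    (b : C₀(M, ℂ)) : fibreSumL s hs (zeroAtInftyPullback s hp a₁ * b * zeroAtInftyPullback s hp a₂)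
      = a₁ * fibreSumL s hs b * a₂ := by
  ext y
  rw [fibreSumL_apply hs hN, ZeroAtInftyContinuousMap.mul_apply,
    ZeroAtInftyContinuousMap.mul_apply, fibreSumL_apply hs hN, mul_finsum_mem, finsum_mem_mul]
  refine finsum_mem_congr rfl fun x hx => ?_
  change a₁ (s x) * b x * a₂ (s x) = _
  rw [show s x = y from hx]

theorem toFibreCompletion_coe (b : C_c(M, ℂ)) :
    toFibreCompletion s hs (compactlySupportedInclusion M b)
      = (fibrePreCorrespondence id continuous_id s hs).ι b :=
  LinearMap.extendOfNorm_eq denseRange_compactlySupportedInclusion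
    ⟨√N, norm_fibrePreCorrespondence_ι_le hs hN⟩ b

theorem denseRange_toFibreCompletion : DenseRange (toFibreCompletion s hs) := by
  refine (fibrePreCorrespondence id continuous_id s hs).denseRange_ι.mono ?_
  rintro _ ⟨b, rfl⟩
  exact ⟨compactlySupportedInclusion M b, toFibreCompletion_coe hs hN b⟩

theorem ip_toFibreCompletion (b c : C₀(M, ℂ)) :
    (fibrePreCorrespondence id continuous_id s hs).completion.ip (toFibreCompletion s hs b)
      (toFibreCompletion s hs c) = fibreSumL s hs (star b * c) := by
  refine denseRange_compactlySupportedInclusion.induction_on₂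
    (p := fun b c => PreCorrespondence.ip _ (toFibreCompletion s hs b) (toFibreCompletion s hs c)
      = fibreSumL s hs (star b * c)) (isClosed_eq ?_ ?_) (fun b c => ?_) b c
  · exact PreCorrespondence.continuous_completion_ip _
      ((toFibreCompletion s hs).continuous.comp continuous_fst)
      ((toFibreCompletion s hs).continuous.comp continuous_snd)
  · exact (fibreSumL s hs).continuous.comp
      ((continuous_star.comp continuous_fst).mul continuous_snd)
  · rw [toFibreCompletion_coe hs hN, toFibreCompletion_coe hs hN,
      PreCorrespondence.completion_ip_ι]
    exact (fibreSumL_coe hs hN (star b * c)).symm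

theorem left_toFibreCompletion (b c : C₀(M, ℂ)) :
    (fibrePreCorrespondence id continuous_id s hs).completion.left b (toFibreCompletion s hs c)
      = toFibreCompletion s hs (b * c) := by
  refine denseRange_compactlySupportedInclusion.induction_on c (isClosed_eq
    ((PreCorrespondence.continuous_completion_left _ b).comp (toFibreCompletion s hs).continuous)
    ((toFibreCompletion s hs).continuous.comp (continuous_const.mul continuous_id))) fun c => ?_
  rw [toFibreCompletion_coe hs hN, PreCorrespondence.completion_left_ι]
  exact (toFibreCompletion_coe hs hN (b • c)).symm

theorem right_toFibreCompletion (hp : IsProperMap s) (b : C₀(M, ℂ)) (a : C₀(Y, ℂ)) :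
    (fibrePreCorrespondence id continuous_id s hs).completion.right a (toFibreCompletion s hs b)
      = toFibreCompletion s hs (b * zeroAtInftyPullback s hp a) := by
  refine denseRange_compactlySupportedInclusion.induction_on b (isClosed_eq
    ((PreCorrespondence.continuous_completion_right _ a).comp (toFibreCompletion s hs).continuous)
    ((toFibreCompletion s hs).continuous.comp (continuous_id.mul continuous_const))) fun b => ?_
  rw [toFibreCompletion_coe hs hN, PreCorrespondence.completion_right_ι, mul_comm]
  exact (toFibreCompletion_coe hs hN (zeroAtInftyPullback s hp a • b)).symm

end BoundedFibres

namespace PreCorrespondence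

section Bounds

variable {W Y X : Type*} [TopologicalSpace W] [TopologicalSpace Y] [NormedAddCommGroup X]
  [NormedSpace ℂ X] (P : PreCorrespondence W Y X) {C : ℝ}

theorem denseRange_toCarrier_comp (hC : ∀ x, ‖P.toCarrier x‖ ≤ C * ‖x‖) {D : Type*} {f : D → X}
    (hf : DenseRange f) : DenseRange (P.toCarrier ∘ f) :=
  P.toCarrier.surjective.denseRange.comp hf
    (AddMonoidHomClass.continuous_of_bound P.toCarrier C hC)

theorem completeSpace_carrier [CompleteSpace X] (hC : ∀ x, ‖P.toCarrier x‖ ≤ C * ‖x‖) {D : ℝ}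
    (hD : ∀ x, ‖x‖ ≤ D * ‖P.toCarrier x‖) : CompleteSpace P.Carrier := by
  let e := P.toCarrier.toContinuousLinearEquivOfBounds C D hC hD
  exact (completeSpace_congr (e := e.toEquiv) e.isUniformEmbedding).1 inferInstance

end Bounds

end PreCorrespondence

namespace Correspondence

variable {W Y X : Type*} [TopologicalSpace W] [TopologicalSpace Y] [NormedAddCommGroup X]
  [NormedSpace ℂ X] (P : Correspondence W Y X)

theorem norm_toCarrier (x : X) : ‖P.toCarrier x‖ = ‖x‖ := by
  rw [← sq_eq_sq₀ (norm_nonneg _) (norm_nonneg _), PreCorrespondence.norm_sq_toCarrier, P.norm_sq]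

theorem eq_zero_of_ip_self {x : X} (h : P.ip x x = 0) : x = 0 := by
  rw [← norm_eq_zero, ← sq_eq_zero_iff, P.norm_sq, h, norm_zero]

end Correspondence

namespace OutSplit

variable {G : TopologicalGraph.{u, v}} (O : OutSplit.{u, v, w} G)

theorem finite_fibre_α (v : G.V) : (O.α ⁻¹' {v}).Finite :=
  finite_fibre_of_isProperMap O.isProperMap_α O.isLocalHomeomorph_α v

theorem HasBoundedFibres.exists_encard_le {O : OutSplit.{u, v, w} G} (h : O.HasBoundedFibres) :
    ∃ N : ℕ, ∀ v, (O.α ⁻¹' {v}).encard ≤ N := by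
  obtain ⟨N, hN⟩ := h
  refine ⟨N, fun v => ?_⟩
  rw [← (O.finite_fibre_α v).cast_ncard_eq]
  exact_mod_cast hN v

theorem expectation_smul_smul (a₁ a₂ : C₀(G.V, ℂ)) (b : C_c(O.Y, ℂ)) :
    O.expectation (zeroAtInftyPullback O.α O.isProperMap_α a₁ •
      zeroAtInftyPullback O.α O.isProperMap_α a₂ • b) = a₁ • a₂ • O.expectation b :=
  (fibreSum_pullbackMul O.isLocalHomeomorph_α a₁ _).trans
    (congrArg (a₁ • ·) (fibreSum_pullbackMul O.isLocalHomeomorph_α a₂ b))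

/-- The `C₀(V)`-`C₀(Y)`-pre-correspondence `C_c(E)` with the inner product along `ψ`. -/
noncomputable def splitPre : PreCorrespondence G.V O.Y C_c(G.E, ℂ) :=
  fibrePreCorrespondence G.r G.continuous_r O.ψ O.isLocalHomeomorph_ψ

theorem finsum_splitPre_ip (x y : C_c(G.E, ℂ)) (v : G.V) :
    ∑ᶠ u ∈ O.α ⁻¹' {v}, O.splitPre.ip x y u = G.preCorrespondence.ip x y v :=
  DFunLike.congr_fun (fibreSum_fibreSum O.isLocalHomeomorph_ψ O.isLocalHomeomorph_α
    G.isLocalHomeomorph_s O.comp_eq (star x * y)) v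

theorem norm_splitPre_ι_le (x : C_c(G.E, ℂ)) : ‖O.splitPre.ι x‖ ≤ 1 * ‖G.ι x‖ := by
  rw [one_mul]
  refine le_of_sq_le_sq ?_ (norm_nonneg _)
  rw [PreCorrespondence.norm_sq_ι, PreCorrespondence.norm_sq_ι]
  exact norm_fibreIp_self_le O.isLocalHomeomorph_ψ O.isLocalHomeomorph_α G.isLocalHomeomorph_s
    O.comp_eq x

/-- The continuous extension to `X(E)` of the identity of `C_c(E)`, with values in the completion
of `C_c(E)` in the inner product along `ψ`. -/
noncomputable def toSplitCompletion : G.GraphModule →L[ℂ] Completion O.splitPre.Carrier :=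
  O.splitPre.ι.extendOfNorm G.ι

theorem toSplitCompletion_ι (x : C_c(G.E, ℂ)) : O.toSplitCompletion (G.ι x) = O.splitPre.ι x :=
  LinearMap.extendOfNorm_eq G.preCorrespondence.denseRange_ι ⟨1, O.norm_splitPre_ι_le⟩ x

theorem norm_toSplitCompletion_le (x : G.GraphModule) : ‖O.toSplitCompletion x‖ ≤ 1 * ‖x‖ :=
  LinearMap.norm_extendOfNorm_apply_le G.preCorrespondence.denseRange_ι 1 O.norm_splitPre_ι_le x

theorem finsum_ip_toSplitCompletion (x y : G.GraphModule) (v : G.V) :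
    ∑ᶠ u ∈ O.α ⁻¹' {v},
        O.splitPre.completion.ip (O.toSplitCompletion x) (O.toSplitCompletion y) u
      = G.correspondence.ip x y v := by
  induction x, y using G.preCorrespondence.induction_ι₂ with
  | hp =>
    exact isClosed_eq
      (continuous_finsum_mem (O.finite_fibre_α v) fun u _ =>
        (PreCorrespondence.continuous_eval u).comp (O.splitPre.continuous_completion_ip
          (O.toSplitCompletion.continuous.comp continuous_fst)
          (O.toSplitCompletion.continuous.comp continuous_snd)))
      ((PreCorrespondence.continuous_eval v).comp
        (G.preCorrespondence.continuous_completion_ip continuous_fst continuous_snd))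
  | h x y =>
    simp_rw [toSplitCompletion_ι, PreCorrespondence.completion_ip_ι]
    exact (O.finsum_splitPre_ip x y v).trans
      (DFunLike.congr_fun (G.preCorrespondence.completion_ip_ι x y).symm v)

theorem toSplitCompletion_injective : Function.Injective O.toSplitCompletion := by
  refine (injective_iff_map_eq_zero _).2 fun x hx => G.correspondence.eq_zero_of_ip_self ?_
  ext v
  rw [← O.finsum_ip_toSplitCompletion, hx, map_zero]
  exact finsum_mem_zero _

/-- The `C₀(Y)`-`C₀(V)`-correspondence `X(E)` with the range map of the edges replaced by `ψ`. Since
`C₀(Y)` is commutative, its left action is the right action of `C₀(Y)` on `X(E)`. -/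
noncomputable def edgeCorrespondence : Correspondence O.Y G.V G.GraphModule :=
  (fibrePreCorrespondence O.ψ O.isLocalHomeomorph_ψ.continuous G.s
    G.isLocalHomeomorph_s).completion

theorem continuous_edgeCorrespondence_left (b : C₀(O.Y, ℂ)) :
    Continuous (O.edgeCorrespondence.left b) :=
  PreCorrespondence.continuous_completion_left _ b

theorem edgeCorrespondence_left_ι (b : C₀(O.Y, ℂ)) (x : C_c(G.E, ℂ)) :
    O.edgeCorrespondence.left b (G.ι x) = G.ι (O.splitPre.right b x) :=
  PreCorrespondence.completion_left_ι _ b x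

theorem correspondence_left_ι (a : C₀(G.V, ℂ)) (x : C_c(G.E, ℂ)) :
    G.correspondence.left a (G.ι x) = G.ι (O.splitPre.left a x) :=
  G.preCorrespondence.completion_left_ι a x

theorem toSplitCompletion_left (a : C₀(G.V, ℂ)) (x : G.GraphModule) :
    O.toSplitCompletion (G.correspondence.left a x)
      = O.splitPre.completion.left a (O.toSplitCompletion x) := by
  induction x using G.preCorrespondence.induction_ι with
  | hp =>
    exact isClosed_eq
      (O.toSplitCompletion.continuous.comp (G.preCorrespondence.continuous_completion_left a))
      ((O.splitPre.continuous_completion_left a).comp O.toSplitCompletion.continuous)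
  | h x =>
    rw [O.correspondence_left_ι, toSplitCompletion_ι, toSplitCompletion_ι,
      PreCorrespondence.completion_left_ι]

theorem toSplitCompletion_edgeCorrespondence_left (b : C₀(O.Y, ℂ)) (x : G.GraphModule) :
    O.toSplitCompletion (O.edgeCorrespondence.left b x)
      = O.splitPre.completion.right b (O.toSplitCompletion x) := by
  induction x using G.preCorrespondence.induction_ι with
  | hp =>
    exact isClosed_eq
      (O.toSplitCompletion.continuous.comp (O.continuous_edgeCorrespondence_left b))
      ((O.splitPre.continuous_completion_right b).comp O.toSplitCompletion.continuous)
  | h x =>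
    rw [O.edgeCorrespondence_left_ι, toSplitCompletion_ι, toSplitCompletion_ι,
      PreCorrespondence.completion_right_ι]

/-- The `C₀(V)`-`C₀(Y)`-pre-correspondence `X(E)`, with the inner product induced from
`toSplitCompletion`. -/
noncomputable def splitModule : PreCorrespondence G.V O.Y G.GraphModule :=
  O.splitPre.completion.comap O.toSplitCompletion.toLinearMap O.toSplitCompletion_injective
    G.correspondence.left O.edgeCorrespondence.left O.toSplitCompletion_left
    O.toSplitCompletion_edgeCorrespondence_left

theorem splitModule_ip (x y : G.GraphModule) : O.splitModule.ip x y
    = O.splitPre.completion.ip (O.toSplitCompletion x) (O.toSplitCompletion y) := rfl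

theorem isIsometricHom_ι : O.splitPre.IsIsometricHom O.splitModule G.ι where
  ip_map x y := by
    rw [splitModule_ip, toSplitCompletion_ι, toSplitCompletion_ι,
      PreCorrespondence.completion_ip_ι]
  map_left a x := (O.correspondence_left_ι a x).symm
  map_right b x := (O.edgeCorrespondence_left_ι b x).symm

theorem splitModule_right_ι (x z : C_c(G.E, ℂ)) (b : C₀(O.Y, ℂ))
    (hz : ∀ e, z e = x e * b (O.ψ e)) : O.splitModule.right b (G.ι x) = G.ι z := by
  rw [← O.isIsometricHom_ι.map_right]
  congr 1
  ext e
  rw [hz, mul_comm]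
  rfl

theorem splitModule_ip_ι_apply (x y : C_c(G.E, ℂ)) (u : O.Y) :
    O.splitModule.ip (G.ι x) (G.ι y) u = ∑ᶠ e ∈ O.ψ ⁻¹' {u}, conj (x e) * y e :=
  DFunLike.congr_fun (O.isIsometricHom_ι.ip_map x y) u

theorem finsum_splitModule_ip (x y : G.GraphModule) (v : G.V) :
    ∑ᶠ u ∈ O.α ⁻¹' {v}, O.splitModule.ip x y u = G.correspondence.ip x y v :=
  O.finsum_ip_toSplitCompletion x y v

theorem eq_zero_of_splitModule_ip_self (x : G.GraphModule) (h : O.splitModule.ip x x = 0) :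
    x = 0 :=
  O.toSplitCompletion_injective <|
    (O.splitPre.completion.eq_zero_of_ip_self h).trans (map_zero _).symm

theorem splitModule_right_pullback (x : G.GraphModule) (a : C₀(G.V, ℂ)) :
    O.splitModule.right (zeroAtInftyPullback O.α O.isProperMap_α a) x
      = G.correspondence.right a x := by
  induction x using G.preCorrespondence.induction_ι with
  | hp =>
    exact isClosed_eq (O.continuous_edgeCorrespondence_left _)
      (G.preCorrespondence.continuous_completion_right a)
  | h x =>
    refine (O.splitModule_right_ι x (G.preCorrespondence.right a x) _ fun e => ?_).trans
      (G.preCorrespondence.completion_right_ι a x).symm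
    change a (G.s e) * x e = x e * a ((O.α ∘ O.ψ) e)
    rw [O.comp_eq, mul_comm]

theorem norm_toCarrier_splitModule_le (x : G.GraphModule) :
    ‖O.splitModule.toCarrier x‖ ≤ 1 * ‖x‖ := by
  rw [PreCorrespondence.norm_toCarrier, splitModule_ip, ← PreCorrespondence.norm_toCarrier,
    Correspondence.norm_toCarrier]
  exact O.norm_toSplitCompletion_le x

theorem denseRange_toCarrier_ι : DenseRange (O.splitModule.toCarrier ∘ G.ι) :=
  O.splitModule.denseRange_toCarrier_comp O.norm_toCarrier_splitModule_le
    G.preCorrespondence.denseRange_ι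

theorem denseRange_toCarrier_expectationPre_ι :
    DenseRange (O.expectationModule.toCarrier ∘ O.expectationPre.ι) :=
  O.expectationModule.denseRange_toCarrier_comp
    (fun x => (O.expectationModule.norm_toCarrier x).le.trans (one_mul _).ge)
    O.expectationPre.denseRange_ι

theorem algTensor_completion_isIsomorphic_tensor :
    (O.expectationPre.algTensor O.splitPre).completion.IsIsomorphic
      (O.expectationModule.tensor O.splitModule) :=
  (O.expectationPre.isIsometricHom_ι.algTensor O.isIsometricHom_ι).completion_isIsomorphic
    (PreCorrespondence.denseRange_toCarrier_map _ _
      O.denseRange_toCarrier_expectationPre_ι O.denseRange_toCarrier_ι)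

theorem algTensor_completion_isIsomorphic_graph :
    (O.expectationPre.algTensor O.splitPre).completion.IsIsomorphic O.graph.correspondence :=
  (isIsometricHom_tensorToPullback O.isLocalHomeomorph_α G.continuous_r O.isLocalHomeomorph_snd
    continuous_id O.isLocalHomeomorph_ψ).completion_isIsomorphic
      ((LinearEquiv.surjective _).comp (tensorToPullback_surjective O.isLocalHomeomorph_α
        G.continuous_r O.isLocalHomeomorph_snd)).denseRange

theorem tensor_isIsomorphic :
    (O.expectationModule.tensor O.splitModule).IsIsomorphic O.graph.correspondence :=
  O.algTensor_completion_isIsomorphic_tensor.symm.trans O.algTensor_completion_isIsomorphic_graph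

section BoundedFibres

variable {O} {N : ℕ} (hN : ∀ v, (O.α ⁻¹' {v}).encard ≤ N)

include hN

theorem fibreSumL_splitModule_ip (x y : G.GraphModule) :
    fibreSumL O.α O.isLocalHomeomorph_α (O.splitModule.ip x y) = G.correspondence.ip x y := by
  ext v
  rw [fibreSumL_apply _ hN, finsum_splitModule_ip]

theorem norm_le_norm_toCarrier_splitModule (x : G.GraphModule) :
    ‖x‖ ≤ √N * ‖O.splitModule.toCarrier x‖ := by
  refine le_of_sq_le_sq ?_ (by positivity)
  rw [mul_pow, Real.sq_sqrt (Nat.cast_nonneg N), PreCorrespondence.norm_sq_toCarrier,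
    G.correspondence.norm_sq]
  refine PreCorrespondence.norm_le_of_forall _ (by positivity) fun v => ?_
  rw [← O.finsum_splitModule_ip]
  exact norm_finsum_mem_le (hN v) (norm_nonneg _) fun u _ => PreCorrespondence.norm_apply_le _ u

theorem completeSpace_carrier_splitModule : CompleteSpace O.splitModule.Carrier :=
  O.splitModule.completeSpace_carrier O.norm_toCarrier_splitModule_le
    (norm_le_norm_toCarrier_splitModule hN)

end BoundedFibres

end OutSplit

theorem mainTheorem8_general (G : TopologicalGraph.{u, v}) (O : OutSplit.{u, v, w} G) :
    ∃ (αs : C₀(G.V, ℂ) →⋆ₙₐ[ℂ] C₀(O.Y, ℂ)) (P : PreCorrespondence G.V O.Y G.GraphModule),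
      (∀ a u, αs a u = a (O.α u)) ∧ Function.Injective αs ∧
      (∀ b v, O.expectation b v = ∑ᶠ u ∈ O.α ⁻¹' {v}, b u) ∧
      (∀ b : C_c(O.Y, ℂ), (∀ u, 0 ≤ b u) → ∀ v, 0 ≤ O.expectation b v) ∧
      (∀ b : C_c(O.Y, ℂ), O.expectation (star b * b) = 0 → b = 0) ∧
      (∀ (a₁ a₂ : C₀(G.V, ℂ)) (b : C_c(O.Y, ℂ)),
        O.expectation (αs a₁ • αs a₂ • b) = a₁ • a₂ • O.expectation b) ∧
      (∀ (x z : C_c(G.E, ℂ)) (b : C₀(O.Y, ℂ)), (∀ e, z e = x e * b (O.ψ e)) →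
        P.right b (G.ι x) = G.ι z) ∧
      (∀ (x y : C_c(G.E, ℂ)) (u : O.Y),
        P.ip (G.ι x) (G.ι y) u = ∑ᶠ e ∈ O.ψ ⁻¹' {u}, conj (x e) * y e) ∧
      (∀ x, P.ip x x = 0 → x = 0) ∧
      P.left = G.correspondence.left ∧
      (∀ x a, P.right (αs a) x = G.correspondence.right a x) ∧
      (∀ x y v, ∑ᶠ u ∈ O.α ⁻¹' {v}, P.ip x y u = G.correspondence.ip x y v) ∧
      (O.expectationModule.tensor P).IsIsomorphic O.graph.correspondence ∧
      (O.HasBoundedFibres →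
        CompleteSpace P.Carrier ∧
        ∃ (Λ : C₀(O.Y, ℂ) →L[ℂ] C₀(G.V, ℂ))
          (q : C₀(O.Y, ℂ) →ₗ[ℂ] Completion O.expectationPre.Carrier),
          (∀ b v, Λ b v = ∑ᶠ u ∈ O.α ⁻¹' {v}, b u) ∧
          (∀ b : C₀(O.Y, ℂ), (∀ u, 0 ≤ b u) → ∀ v, 0 ≤ Λ b v) ∧
          (∀ b, Λ (star b * b) = 0 → b = 0) ∧
          (∀ a₁ a₂ b, Λ (αs a₁ * b * αs a₂) = a₁ * Λ b * a₂) ∧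
          (∀ x y, Λ (P.ip x y) = G.correspondence.ip x y) ∧
          (∀ b : C_c(O.Y, ℂ), q b = O.expectationPre.ι b) ∧ DenseRange q ∧
          (∀ b c, O.expectationModule.ip (q b) (q c) = Λ (star b * c)) ∧
          (∀ b c, O.expectationModule.left b (q c) = q (b * c)) ∧
          (∀ b a, O.expectationModule.right a (q b) = q (b * αs a))) := by
  refine ⟨zeroAtInftyPullback O.α O.isProperMap_α, O.splitModule,
    zeroAtInftyPullback_apply O.isProperMap_α,
    zeroAtInftyPullback_injective O.isProperMap_α O.surjective_α, fun _ _ => rfl,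
    fibreSum_nonneg O.α O.isLocalHomeomorph_α,
    fun _ => eq_zero_of_fibreSum_star_mul_self O.isLocalHomeomorph_α, O.expectation_smul_smul,
    O.splitModule_right_ι, O.splitModule_ip_ι_apply, O.eq_zero_of_splitModule_ip_self, rfl,
    O.splitModule_right_pullback, O.finsum_splitModule_ip, O.tensor_isIsomorphic, fun h => ?_⟩
  obtain ⟨N, hN⟩ := h.exists_encard_le
  have hα := O.isLocalHomeomorph_α
  exact ⟨OutSplit.completeSpace_carrier_splitModule hN, fibreSumL O.α hα,
    (toFibreCompletion O.α hα).toLinearMap, fibreSumL_apply hα hN, fibreSumL_nonneg hα hN,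
    eq_zero_of_fibreSumL_star_mul_self hα hN,
    fibreSumL_pullback_mul_mul_pullback hα hN O.isProperMap_α,
    OutSplit.fibreSumL_splitModule_ip hN, toFibreCompletion_coe hα hN,
    denseRange_toFibreCompletion hα hN, ip_toFibreCompletion hα hN, left_toFibreCompletion hα hN,
    right_toFibreCompletion hα hN O.isProperMap_α⟩

theorem mainTheorem8 (G : TopologicalGraph.{u, v}) (hG : G.IsRegular) (O : OutSplit.{u, v, w} G) :
    ∃ (αs : C₀(G.V, ℂ) →⋆ₙₐ[ℂ] C₀(O.Y, ℂ)) (P : PreCorrespondence G.V O.Y G.GraphModule),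
      -- `αs` is the injective `*`-homomorphism `a ↦ a ∘ α`
      (∀ a u, αs a u = a (O.α u)) ∧ Function.Injective αs ∧
      -- the map `Λ` on `C_c(Y)`: formula, positivity, faithfulness, compatibility with `αs`
      (∀ b v, O.expectation b v = ∑ᶠ u ∈ O.α ⁻¹' {v}, b u) ∧
      (∀ b : C_c(O.Y, ℂ), (∀ u, 0 ≤ b u) → ∀ v, 0 ≤ O.expectation b v) ∧
      (∀ b : C_c(O.Y, ℂ), O.expectation (star b * b) = 0 → b = 0) ∧
      (∀ (a₁ a₂ : C₀(G.V, ℂ)) (b : C_c(O.Y, ℂ)),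
        O.expectation (αs a₁ • αs a₂ • b) = a₁ • a₂ • O.expectation b) ∧
      -- the right `C₀(Y)`-module structure `P` on `X(E)`: the formulae on `C_c(E)`
      (∀ (x z : C_c(G.E, ℂ)) (b : C₀(O.Y, ℂ)), (∀ e, z e = x e * b (O.ψ e)) →
        P.right b (G.ι x) = G.ι z) ∧
      (∀ (x y : C_c(G.E, ℂ)) (u : O.Y),
        P.ip (G.ι x) (G.ι y) u = ∑ᶠ e ∈ O.ψ ⁻¹' {u}, conj (x e) * y e) ∧
      (∀ x, P.ip x x = 0 → x = 0) ∧
      -- the left action on `P` (by adjointable operators) is that of `X(E)`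
      P.left = G.correspondence.left ∧
      -- `P` is compatible with `αs` and `Λ`
      (∀ x a, P.right (αs a) x = G.correspondence.right a x) ∧
      (∀ x y v, ∑ᶠ u ∈ O.α ⁻¹' {v}, P.ip x y u = G.correspondence.ip x y v) ∧
      -- the out-split correspondence is isomorphic to the correspondence of the out-split graph
      (O.expectationModule.tensor P).IsIsomorphic O.graph.correspondence ∧
      -- if the fibres of `α` are uniformly bounded, then `Λ` is defined on `C₀(Y)`, `X(E)` is complete
      -- as a `C₀(Y)`-module, and `B^Λ` is the completion of `C₀(Y)`
      (O.HasBoundedFibres →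
        CompleteSpace P.Carrier ∧
        ∃ (Λ : C₀(O.Y, ℂ) →L[ℂ] C₀(G.V, ℂ))
          (q : C₀(O.Y, ℂ) →ₗ[ℂ] Completion O.expectationPre.Carrier),
          (∀ b v, Λ b v = ∑ᶠ u ∈ O.α ⁻¹' {v}, b u) ∧
          (∀ b : C₀(O.Y, ℂ), (∀ u, 0 ≤ b u) → ∀ v, 0 ≤ Λ b v) ∧
          (∀ b, Λ (star b * b) = 0 → b = 0) ∧
          (∀ a₁ a₂ b, Λ (αs a₁ * b * αs a₂) = a₁ * Λ b * a₂) ∧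
          (∀ x y, Λ (P.ip x y) = G.correspondence.ip x y) ∧
          (∀ b : C_c(O.Y, ℂ), q b = O.expectationPre.ι b) ∧ DenseRange q ∧
          (∀ b c, O.expectationModule.ip (q b) (q c) = Λ (star b * c)) ∧
          (∀ b c, O.expectationModule.left b (q c) = q (b * c)) ∧
          (∀ b a, O.expectationModule.right a (q b) = q (b * αs a))) :=
  mainTheorem8_general G O
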